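/- Fix a countably infinite set $\mathbb{A}$ of names and let $\mathrm{Perm}\,\mathbb{A}$ be the group of finite permutations of $\mathbb{A}$. A nominal set is a $\mathrm{Perm}\,\mathbb{A}$-set whose elements are all finitely supported; $\operatorname{supp} x$ is the least finite support of $x$. A nominal set is orbit-finite if it has finitely many orbits, and $k$-bounded if $|\operatorname{supp} x|\le k$ for all its elements $x$. A subset is orbit-finite if it is finitely supported and meets only finitely many orbits. Let $\Sigma$ be an orbit-finite nominal set, $k\in\mathbb{N}$, and $s\colon \Sigma^*\to\mathcal{P}_k\mathbb{A}=\{S\subseteq\mathbb{A}\mid |S|\le k\}$ a support bound (an arbitrary map). A map $h$ from $\Sigma^*$ to a nominal monoid is $s$-bounded if $\operatorname{supp} h(w)\subseteq s(w)$ for all $w\in\Sigma^*$. Let $\mathrm{Rec}_s(\Sigma^*)$ be the set of all languages $h^{-1}[P]\subseteq\Sigma^*$, where $h\colon\Sigma^*\to M$ is an $s$-bounded equivariant monoid morphism into an orbit-finite nominal monoid and $P\subseteq M$ is finitely supported, with the set-theoretic boolean operations. Let $\widehat{\Sigma^*_s}$ be the limit of all $s$-bounded surjective equivariant monoid morphisms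 $e\colon\Sigma^*\to M$ onto $k$-bounded orbit-finite nominal monoids $M$, i.e. the set of all compatible families $(x_e)_e$ with $x_e\in M$, with pointwise action and the initial nominal topology for the projections to the discrete spaces $M$; let $\eta\colon\Sigma^*\to\widehat{\Sigma^*_s}$, $\eta(w)=(e(w))_e$. A nominal topology on a nominal set is an equivariant family of finitely supported subsets (the open sets) that is closed under finitely supported unions and finite intersections. A $k$-bounded nominal Stone space is a $k$-bounded nominal set with a nominal topology that is compact (every finitely supported open cover has an orbit-finite subcover), Hausdorff (for every finite $S\subseteq\mathbb{A}$, points in different $S$-orbits, i.e. orbits under the finite permutations fixing $S$ pointwise, have disjoint $S$-supported open neighbourhoods), and has a basis of representable sets (sets $f^{-1}[P]$ with $f$ a continuous equivariant map to an orbit-finite discrete space and $P$ finitely supported). For a nominal topological space $X$, $\mathrm{Clo}(X)$ is the nominal boolean algebra of its clopen sets. A nominal boolean algebra $B$ (a boolean algebra on a nominal set, with equivariant operations) is orbit-finitely complete if every orbit-finite subset has a supremum; it is locally $k$-atomic if every element lies in an equivariant boolean subalgebra, closed under suprema of orbit-finite subsets, in which every element is the supremum of the atoms below it and whose set of atoms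 is orbit-finite and $k$-bounded. Isomorphisms of such algebras are equivariant boolean isomorphisms that, with their inverses, preserve suprema of orbit-finite subsets. $\mathcal{F}_p(B)$ is the space of nominal orbit-finitely complete prime filters of $B$, i.e. finitely supported, nonempty, upwards closed subsets $F\subseteq B$ closed under binary meets such that $\bigvee Y\in F$ implies $Y\cap F\neq\emptyset$ for every orbit-finite $Y\subseteq B$ that has a supremum and whose elements have support of size at most $k$; its topology is generated by the sets $\{F\mid b\in F\}$, $b\in B$. **Theorem.** The space $\widehat{\Sigma^*_s}$ is a $k$-bounded nominal Stone space, $\mathrm{Rec}_s(\Sigma^*)$ is a locally $k$-atomic orbit-finitely complete nominal boolean algebra, and the two are dual to each other under nominal Stone duality $X\mapsto\mathrm{Clo}(X)$, $B\mapsto\mathcal{F}_p(B)$: 1. $\mathrm{Clo}(\widehat{\Sigma^*_s})$ is a locally $k$-atomic orbit-finitely complete nominal boolean algebra, and $$\mathrm{Rec}_s(\Sigma^*)\;\cong\;\mathrm{Clo}(\widehat{\Sigma^*_s})$$ as orbit-finitely complete nominal boolean algebras, via the mutually inverse maps $L\mapsto\overline{\eta[L]}$ (topological closure) and $C\mapsto\eta^{-1}[C]$.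 2. $\mathcal{F}_p(\mathrm{Rec}_s(\Sigma^*))$ is a $k$-bounded nominal Stone space, and $x\mapsto\{L\in \mathrm{Rec}_s(\Sigma^*)\mid x\in\overline{\eta[L]}\}$ is an equivariant homeomorphism $\widehat{\Sigma^*_s}\cong\mathcal{F}_p(\mathrm{Rec}_s(\Sigma^*))$. -/

import Mathlib

open scoped Pointwise

universe u v

namespace NominalStone

/-! ## Names, finite permutations, supports, nominal sets -/

/-- The subgroup of finite permutations of the set `A` of names. -/
def finPermSubgroup (A : Type v) : Subgroup (Equiv.Perm A) where
  carrier := {π | {a | π a ≠ a}.Finite}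
  one_mem' := by simp
  mul_mem' := by
    intro π σ hπ hσ
    refine (hπ.union hσ).subset fun a ha => ?_
    by_contra h
    simp only [Set.mem_union, Set.mem_ofPred_eq, not_or, not_not] at h
    exact ha (by rw [Equiv.Perm.mul_apply, h.2, h.1])
  inv_mem' := by
    intro π hπ
    refine Set.Finite.subset hπ fun a ha h => ha ?_
    rw [Equiv.Perm.inv_eq_iff_eq]
    exact h.symm

/-- The group `Perm A` of finite permutations of `A`; it acts on `A` by evaluation. -/
abbrev FinPerm (A : Type v) : Type v := ↥(finPermSubgroup A)

/-- `x` has a finite support. -/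
def FinSupp (A : Type v) {X : Type*} [MulAction (FinPerm A) X] (x : X) : Prop :=
  ∃ S : Finset A, MulAction.Supports (FinPerm A) (S : Set A) x

/-- Nominal sets: every element has a finite support. -/
def IsNominal (A : Type v) (X : Type*) [MulAction (FinPerm A) X] : Prop :=
  ∀ x : X, FinSupp A x

/-- `supp x`, the intersection of all finite supports of `x`
(the least finite support, see `supports_supp`). -/
def supp (A : Type v) {X : Type*} [MulAction (FinPerm A) X] (x : X) : Set A :=
  ⋂₀ {S | S.Finite ∧ MulAction.Supports (FinPerm A) S x}

/-- A set `Y` all of whose elements have (least) support of size at most `k`. -/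
def KBoundedSet (A : Type v) {X : Type*} [MulAction (FinPerm A) X] (k : ℕ) (Y : Set X) : Prop :=
  ∀ y ∈ Y, (supp A y).encard ≤ k

/-- `k`-bounded nominal sets. -/
def IsKBounded (A : Type v) (X : Type*) [MulAction (FinPerm A) X] (k : ℕ) : Prop :=
  KBoundedSet A k (Set.univ : Set X)

/-- An orbit-finite set: it has finitely many orbits. -/
def OrbitFinite (A : Type v) (X : Type*) [MulAction (FinPerm A) X] : Prop :=
  Finite (MulAction.orbitRel.Quotient (FinPerm A) X)

/-- An orbit-finite subset: finitely supported, and meeting only finitely many orbits. -/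
def OrbitFiniteSet (A : Type v) {X : Type*} [MulAction (FinPerm A) X] (Y : Set X) : Prop :=
  FinSupp A Y ∧ (MulAction.orbit (FinPerm A) '' Y).Finite

/-- Equivariant maps. -/
def Equivariant (A : Type v) {X Y : Type*} [MulAction (FinPerm A) X] [MulAction (FinPerm A) Y]
    (f : X → Y) : Prop :=
  ∀ (π : FinPerm A) (x : X), f (π • x) = π • f x

/-- The `S`-orbit of `x`. -/
def orbS {A : Type v} {X : Type*} [MulAction (FinPerm A) X] (S : Finset A) (x : X) : Set X :=
  {y | ∃ π : FinPerm A, (∀ a ∈ S, π • a = a) ∧ π • x = y}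

section BasicFacts

variable {A : Type v} {X Y Z : Type*} [MulAction (FinPerm A) X] [MulAction (FinPerm A) Y]
  [MulAction (FinPerm A) Z]

theorem FinSupp.map {x : X} (hx : FinSupp A x) (f : X → Y)
    (hf : ∀ π : FinPerm A, f (π • x) = π • f x) : FinSupp A (f x) := by
  obtain ⟨S, hS⟩ := hx
  exact ⟨S, fun π hπ => by rw [← hf, hS π hπ]⟩

theorem FinSupp.map₂ {x : X} {y : Y} (hx : FinSupp A x) (hy : FinSupp A y) (f : X → Y → Z)
    (hf : ∀ π : FinPerm A, f (π • x) (π • y) = π • f x y) : FinSupp A (f x y) := by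
  classical
  obtain ⟨S, hS⟩ := hx
  obtain ⟨T, hT⟩ := hy
  refine ⟨S ∪ T, fun π hπ => ?_⟩
  rw [← hf, hS π fun a ha => hπ (by simp [Finset.mem_coe.1 ha]),
    hT π fun a ha => hπ (by simp [Finset.mem_coe.1 ha])]

theorem FinSupp.smul {x : X} (hx : FinSupp A x) (σ : FinPerm A) : FinSupp A (σ • x) := by
  classical
  obtain ⟨S, hS⟩ := hx
  refine ⟨S.image fun a => σ • a, fun π hπ => ?_⟩
  have h : (σ⁻¹ * π * σ) • x = x := hS _ fun a ha => by
    have := hπ (a := σ • a) (Finset.mem_coe.2 (Finset.mem_image_of_mem _ ha))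
    rw [mul_smul, mul_smul, this, inv_smul_smul]
  rw [mul_smul, mul_smul, inv_smul_eq_iff] at h
  exact h

theorem smul_sUnion (π : FinPerm A) (𝒰 : Set (Set X)) : π • ⋃₀ 𝒰 = ⋃₀ (π • 𝒰) := by
  ext x
  simp only [Set.mem_smul_set_iff_inv_smul_mem, Set.mem_sUnion]
  constructor
  · rintro ⟨U, hU, hx⟩
    exact ⟨π • U, by simpa using hU, by simpa [Set.mem_smul_set_iff_inv_smul_mem] using hx⟩
  · rintro ⟨U, hU, hx⟩
    exact ⟨π⁻¹ • U, hU, by simpa using hx⟩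

theorem smul_preimage {f : X → Y} (hf : Equivariant A f) (π : FinPerm A) (P : Set Y) :
    π • (f ⁻¹' P) = f ⁻¹' (π • P) := by
  ext x
  rw [Set.mem_smul_set_iff_inv_smul_mem, Set.mem_preimage, Set.mem_preimage,
    Set.mem_smul_set_iff_inv_smul_mem, hf]

/-- An injection on a finite set of names extends to a finite permutation. -/
theorem exists_perm_extending (T : Finset A) (f : A → A) (hf : Set.InjOn f T) :
    ∃ π : FinPerm A, ∀ a ∈ T, π • a = f a := by
  classical
  let W : Finset A := T ∪ T.image f
  let e₀ : {x : W // (x : A) ∈ T} ≃ {x : W // (x : A) ∈ T.image f} :=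
    Equiv.ofBijective
      (fun x => ⟨⟨f x.1.1, Finset.mem_union_right _ (Finset.mem_image_of_mem f x.2)⟩,
        Finset.mem_image_of_mem f x.2⟩)
      ⟨fun x y h => by
        have h' : f x.1.1 = f y.1.1 := congrArg (fun z => (z.1.1 : A)) h
        exact Subtype.ext (Subtype.ext (hf x.2 y.2 h')),
      fun y => by
        obtain ⟨a, ha, hay⟩ := Finset.mem_image.1 y.2
        exact ⟨⟨⟨a, Finset.mem_union_left _ ha⟩, ha⟩, Subtype.ext (Subtype.ext hay)⟩⟩
  refine ⟨⟨Equiv.Perm.ofSubtype (p := fun x => x ∈ W) e₀.extendSubtype, ?_⟩, fun a ha => ?_⟩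
  · refine Set.Finite.subset W.finite_toSet fun a ha => ?_
    by_contra h
    exact ha (Equiv.Perm.ofSubtype_apply_of_not_mem _ h)
  · change Equiv.Perm.ofSubtype (p := fun x => x ∈ W) e₀.extendSubtype a = f a
    have haW : a ∈ W := Finset.mem_union_left _ ha
    rw [Equiv.Perm.ofSubtype_apply_of_mem _ haW,
      Equiv.extendSubtype_apply_of_mem e₀ ⟨a, haW⟩ ha]
    rfl

theorem exists_fresh_inj [Infinite A] (D F : Finset A) :
    ∃ g : A → A, Set.InjOn g D ∧ ∀ a ∈ D, g a ∉ F := by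
  classical
  have hinf : Infinite {a // a ∉ F} := (Finset.finite_toSet F).infinite_compl.to_subtype
  let j : D ↪ {a // a ∉ F} :=
    D.equivFin.toEmbedding.trans (Fin.valEmbedding.trans (Infinite.natEmbedding _))
  refine ⟨fun a => if h : a ∈ D then (j ⟨a, h⟩).1 else a, fun a ha b hb hab => ?_,
    fun a ha => ?_⟩
  · have ha' : a ∈ D := ha
    have hb' : b ∈ D := hb
    simp only [ha', hb', dif_pos] at hab
    exact congrArg Subtype.val (j.injective (Subtype.ext hab))
  · simp only [ha, dif_pos]
    exact (j ⟨a, ha⟩).2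

theorem supports_inter [Infinite A] {S T : Finset A} {x : X}
    (hS : MulAction.Supports (FinPerm A) (S : Set A) x)
    (hT : MulAction.Supports (FinPerm A) (T : Set A) x) :
    MulAction.Supports (FinPerm A) ((S : Set A) ∩ T) x := by
  classical
  intro π hπ
  have hfin : {a | (π : Equiv.Perm A) a ≠ a}.Finite := π.2
  obtain ⟨g, hg, hgF⟩ := exists_fresh_inj (S \ T) (S ∪ T ∪ hfin.toFinset)
  obtain ⟨τ, hτ⟩ := exists_perm_extending (S ∪ T) (fun a => if a ∈ T then a else g a) (by
    intro a ha b hb hab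
    have ha' : a ∈ S ∪ T := ha
    have hb' : b ∈ S ∪ T := hb
    by_cases haT : a ∈ T <;> by_cases hbT : b ∈ T <;> simp only [haT, hbT, if_true, if_false] at hab
    · exact hab
    · have := hgF b (by simp_all)
      exact absurd (by simp [← hab, haT]) this
    · have := hgF a (by simp_all)
      exact absurd (by simp [hab, hbT]) this
    · exact hg (by simp_all) (by simp_all) hab)
  have hτx : τ • x = x := hT τ fun a ha => by
    have ha' : a ∈ T := ha
    rw [hτ a (by simp [ha']), if_pos ha']
  have h : (τ⁻¹ * π * τ) • x = x := hS _ fun a ha => by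
    have ha' : a ∈ S := ha
    rw [mul_smul, mul_smul, inv_smul_eq_iff]
    by_cases haT : a ∈ T
    · have : τ • a = a := by rw [hτ a (by simp [ha']), if_pos haT]
      rw [this]
      exact hπ ⟨ha, haT⟩
    · have h1 : τ • a = g a := by rw [hτ a (by simp [ha']), if_neg haT]
      have h2 := hgF a (by simp [ha', haT])
      rw [h1]
      by_contra h3
      exact h2 (Finset.mem_union_right _ (hfin.mem_toFinset.2 h3))
  rw [mul_smul, mul_smul, inv_smul_eq_iff, hτx] at h
  exact h

/-- `supp x` is a finite support of `x`, and by definition it lies in every finite support. -/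
theorem supports_supp [Infinite A] {x : X} (hx : FinSupp A x) :
    (supp A x).Finite ∧ MulAction.Supports (FinPerm A) (supp A x) x := by
  classical
  have hex : ∃ n, ∃ S : Finset A, S.card = n ∧ MulAction.Supports (FinPerm A) (S : Set A) x := by
    obtain ⟨S, hS⟩ := hx
    exact ⟨_, S, rfl, hS⟩
  obtain ⟨S, hcard, hS⟩ := Nat.find_spec hex
  have hle : ∀ T : Finset A, MulAction.Supports (FinPerm A) (T : Set A) x → S ⊆ T := by
    intro T hT
    have h1 : MulAction.Supports (FinPerm A) ((S ∩ T : Finset A) : Set A) x := by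
      rw [Finset.coe_inter]
      exact supports_inter hS hT
    have h2 : S.card ≤ (S ∩ T).card := by
      rw [hcard]
      exact Nat.find_min' hex ⟨_, rfl, h1⟩
    rw [← Finset.eq_of_subset_of_card_le Finset.inter_subset_left h2]
    exact Finset.inter_subset_right
  have heq : supp A x = (S : Set A) := by
    apply Set.Subset.antisymm
    · exact Set.sInter_subset_of_mem ⟨S.finite_toSet, hS⟩
    · refine Set.subset_sInter ?_
      rintro T ⟨hTf, hT⟩
      have := hle hTf.toFinset (by rwa [hTf.coe_toFinset])
      intro a ha
      exact hTf.mem_toFinset.1 (this ha)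
  rw [heq]
  exact ⟨S.finite_toSet, hS⟩

theorem supp_subset_iff [Infinite A] {x : X} (hx : FinSupp A x) (S : Finset A) :
    supp A x ⊆ S ↔ MulAction.Supports (FinPerm A) (S : Set A) x :=
  ⟨fun h => (supports_supp hx).2.mono h, fun h => Set.sInter_subset_of_mem ⟨S.finite_toSet, h⟩⟩

/-- An orbit splits into finitely many `S`-orbits. -/
theorem exists_finite_orbS_reps [Infinite A] (S : Finset A) {x : X} (hx : FinSupp A x) :
    ∃ R : Set X, R.Finite ∧ ∀ σ : FinPerm A, ∃ π : FinPerm A, (∀ a ∈ S, π • a = a) ∧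
      π • σ • x ∈ R := by
  classical
  obtain ⟨T, hT⟩ := hx
  obtain ⟨g, hg, hgF⟩ := exists_fresh_inj T S
  let W : Finset A := S ∪ T.image g
  refine ⟨{y | ∃ ρ : FinPerm A, (∀ a ∈ T, ρ • a ∈ W) ∧ ρ • x = y}, ?_, fun σ => ?_⟩
  · rw [← Set.finite_coe_iff]
    let r : {y // ∃ ρ : FinPerm A, (∀ a ∈ T, ρ • a ∈ W) ∧ ρ • x = y} → (T → W) :=
      fun y a => ⟨y.2.choose • (a : A), y.2.choose_spec.1 a a.2⟩
    refine Finite.of_injective r fun y z hyz => Subtype.ext ?_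
    rw [← y.2.choose_spec.2, ← z.2.choose_spec.2, ← inv_smul_eq_iff, ← mul_smul]
    refine hT _ fun a ha => ?_
    have h : y.2.choose • a = z.2.choose • a := congrArg Subtype.val (congrFun hyz ⟨a, ha⟩)
    rw [mul_smul, h, inv_smul_smul]
  · obtain ⟨π, hπ⟩ := exists_perm_extending (S ∪ T.image fun a => σ • a)
      (fun a => if a ∈ S then a else g (σ⁻¹ • a)) (by
        intro a ha b hb hab
        have ha' : a ∉ S → σ⁻¹ • a ∈ T := fun h => by
          obtain ⟨t, ht, rfl⟩ := Finset.mem_image.1 ((Finset.mem_union.1 ha).resolve_left h)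
          simpa using ht
        have hb' : b ∉ S → σ⁻¹ • b ∈ T := fun h => by
          obtain ⟨t, ht, rfl⟩ := Finset.mem_image.1 ((Finset.mem_union.1 hb).resolve_left h)
          simpa using ht
        by_cases haS : a ∈ S <;> by_cases hbS : b ∈ S <;>
          simp only [haS, hbS, if_true, if_false] at hab
        · exact hab
        · exact absurd (hab ▸ haS) (hgF _ (hb' hbS))
        · exact absurd (hab ▸ hbS) (hgF _ (ha' haS))
        · exact MulAction.injective σ⁻¹ (hg (ha' haS) (hb' hbS) hab))
    refine ⟨π, fun a ha => by rw [hπ a (Finset.mem_union_left _ ha), if_pos ha], π * σ,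
      fun a ha => ?_, mul_smul _ _ _⟩
    rw [mul_smul, hπ _ (Finset.mem_union_right _ (Finset.mem_image_of_mem _ ha))]
    split_ifs with h
    · exact Finset.mem_union_left _ h
    · rw [inv_smul_smul]
      exact Finset.mem_union_right _ (Finset.mem_image_of_mem _ ha)

/-- Orbit-finite nominal sets are closed under binary products. -/
theorem OrbitFinite.prod [Infinite A] (hX : IsNominal A X) (hY : IsNominal A Y)
    (hX' : OrbitFinite A X) (hY' : OrbitFinite A Y) : OrbitFinite A (X × Y) := by
  classical
  have : Finite (MulAction.orbitRel.Quotient (FinPerm A) X) := hX'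
  have : Finite (MulAction.orbitRel.Quotient (FinPerm A) Y) := hY'
  let p : MulAction.orbitRel.Quotient (FinPerm A) X → X := Quotient.out
  let q : MulAction.orbitRel.Quotient (FinPerm A) Y → Y := Quotient.out
  have hp : ∀ x : X, ∃ i, ∃ τ : FinPerm A, τ • p i = x := fun x => by
    refine ⟨Quotient.mk (MulAction.orbitRel (FinPerm A) X) x, ?_⟩
    have h : (MulAction.orbitRel (FinPerm A) X)
        (p (Quotient.mk (MulAction.orbitRel (FinPerm A) X) x)) x :=
      @Quotient.exact _ (MulAction.orbitRel (FinPerm A) X) _ _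
        (@Quotient.out_eq _ (MulAction.orbitRel (FinPerm A) X) _)
    exact MulAction.orbitRel_apply.1 (Setoid.symm' _ h)
  have hq : ∀ y : Y, ∃ j, ∃ τ : FinPerm A, τ • q j = y := fun y => by
    refine ⟨Quotient.mk (MulAction.orbitRel (FinPerm A) Y) y, ?_⟩
    have h : (MulAction.orbitRel (FinPerm A) Y)
        (q (Quotient.mk (MulAction.orbitRel (FinPerm A) Y) y)) y :=
      @Quotient.exact _ (MulAction.orbitRel (FinPerm A) Y) _ _
        (@Quotient.out_eq _ (MulAction.orbitRel (FinPerm A) Y) _)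
    exact MulAction.orbitRel_apply.1 (Setoid.symm' _ h)
  choose S hS using fun i => hX (p i)
  choose R hRf hR using fun i j => exists_finite_orbS_reps (S i) (hY (q j))
  have hfin : (⋃ i, ⋃ j, (fun y => (p i, y)) '' R i j).Finite :=
    Set.finite_iUnion fun i => Set.finite_iUnion fun j => (hRf i j).image _
  have := hfin.to_subtype
  refine Finite.of_surjective
    (fun z : ↥(⋃ i, ⋃ j, (fun y => (p i, y)) '' R i j) =>
      (Quotient.mk _ z.1 : MulAction.orbitRel.Quotient (FinPerm A) (X × Y))) fun z => ?_
  obtain ⟨⟨x, y⟩, rfl⟩ := Quotient.exists_rep z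
  obtain ⟨i, τ, rfl⟩ := hp x
  obtain ⟨j, σ, hσ⟩ := hq (τ⁻¹ • y)
  obtain ⟨π, hπ, hπR⟩ := hR i j σ
  refine ⟨⟨(p i, π • σ • q j), Set.mem_iUnion.2 ⟨i, Set.mem_iUnion.2 ⟨j, _, hπR, rfl⟩⟩⟩,
    Quotient.sound ?_⟩
  change MulAction.orbitRel (FinPerm A) (X × Y) _ _
  rw [MulAction.orbitRel_apply]
  refine ⟨π * τ⁻¹, ?_⟩
  ext
  · change (π * τ⁻¹) • τ • p i = p i
    rw [mul_smul, inv_smul_smul]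
    exact hS i π fun a ha => hπ a ha
  · change (π * τ⁻¹) • y = π • σ • q j
    rw [mul_smul, hσ]

end BasicFacts

/-! ## Nominal topological spaces -/

/-- A nominal topology: an equivariant collection of finitely supported subsets, closed under
finitely supported unions and finite intersections. -/
structure NomTop (A : Type v) (X : Type u) [MulAction (FinPerm A) X] where
  IsOpen : Set X → Prop
  finSupp : ∀ U, IsOpen U → FinSupp A U
  smul : ∀ (π : FinPerm A) U, IsOpen U → IsOpen (π • U)
  sUnion : ∀ 𝒰 : Set (Set X), FinSupp A 𝒰 → (∀ U ∈ 𝒰, IsOpen U) → IsOpen (⋃₀ 𝒰)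
  inter : ∀ U V, IsOpen U → IsOpen V → IsOpen (U ∩ V)
  univ : IsOpen Set.univ

/-- The finite intersections of members of `𝓑` (the empty one being the whole set). -/
def finiteInters {X : Type*} (𝓑 : Set (Set X)) : Set (Set X) :=
  {W | ∃ F : Set (Set X), F.Finite ∧ F ⊆ 𝓑 ∧ W = ⋂₀ F}

/-- `U` is a finitely supported union of members of `𝒲`. -/
def IsFSUnion (A : Type v) {X : Type*} [MulAction (FinPerm A) X] (𝒲 : Set (Set X)) (U : Set X) :
    Prop :=
  ∃ 𝒰 : Set (Set X), FinSupp A 𝒰 ∧ 𝒰 ⊆ 𝒲 ∧ U = ⋃₀ 𝒰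

section Generate

variable {A : Type v} {X : Type u} [MulAction (FinPerm A) X]

theorem smul_mem_finiteInters {𝓑 : Set (Set X)} (h𝓑 : ∀ (π : FinPerm A), ∀ W ∈ 𝓑, π • W ∈ 𝓑)
    (π : FinPerm A) {W : Set X} (hW : W ∈ finiteInters 𝓑) : π • W ∈ finiteInters 𝓑 := by
  obtain ⟨F, hF, hFB, rfl⟩ := hW
  refine ⟨(fun V => π • V) '' F, hF.image _, ?_, ?_⟩
  · rintro _ ⟨V, hV, rfl⟩
    exact h𝓑 π V (hFB hV)
  · ext x
    rw [Set.mem_smul_set_iff_inv_smul_mem]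
    simp only [Set.mem_sInter, Set.forall_mem_image, Set.mem_smul_set_iff_inv_smul_mem]

theorem isFSUnion_iff {𝒲 : Set (Set X)} (h𝒲 : ∀ (π : FinPerm A), ∀ W ∈ 𝒲, π • W ∈ 𝒲)
    (U : Set X) : IsFSUnion A 𝒲 U ↔ FinSupp A U ∧ ∀ x ∈ U, ∃ W ∈ 𝒲, x ∈ W ∧ W ⊆ U := by
  constructor
  · rintro ⟨𝒰, hfs, hsub, rfl⟩
    refine ⟨hfs.map (fun 𝒱 => ⋃₀ 𝒱) fun π => (smul_sUnion π 𝒰).symm, ?_⟩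
    rintro x ⟨W, hW, hx⟩
    exact ⟨W, hsub hW, hx, Set.subset_sUnion_of_mem hW⟩
  · rintro ⟨⟨S, hS⟩, h⟩
    refine ⟨{W | W ∈ 𝒲 ∧ W ⊆ U}, ⟨S, fun π hπ => ?_⟩, fun W hW => hW.1, ?_⟩
    · have hU := hS π hπ
      have hU' : π⁻¹ • U = U := by rw [inv_smul_eq_iff, hU]
      ext W
      rw [Set.mem_smul_set_iff_inv_smul_mem]
      constructor
      · rintro ⟨h1, h2⟩
        refine ⟨by simpa using h𝒲 π _ h1, ?_⟩
        rw [← hU'] at h2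
        exact Set.smul_set_subset_smul_set_iff.1 h2
      · rintro ⟨h1, h2⟩
        refine ⟨h𝒲 _ _ h1, ?_⟩
        rw [← hU']
        exact Set.smul_set_subset_smul_set_iff.2 h2
    · ext x
      constructor
      · intro hx
        obtain ⟨W, hW, hxW, hWU⟩ := h x hx
        exact ⟨W, ⟨hW, hWU⟩, hxW⟩
      · rintro ⟨W, hW, hx⟩
        exact hW.2 hx

/-- The nominal topology generated by an equivariant subbasis: the open sets are the finitely
supported unions of finite intersections of members of the subbasis. -/
def NomTop.generate (𝓑 : Set (Set X)) (h𝓑 : ∀ (π : FinPerm A), ∀ W ∈ 𝓑, π • W ∈ 𝓑) :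
    NomTop A X where
  IsOpen := IsFSUnion A (finiteInters 𝓑)
  finSupp U hU := ((isFSUnion_iff (fun π _ => smul_mem_finiteInters h𝓑 π) U).1 hU).1
  smul := by
    intro π U hU
    rw [isFSUnion_iff (fun π _ => smul_mem_finiteInters h𝓑 π)] at hU ⊢
    refine ⟨hU.1.smul π, fun x hx => ?_⟩
    obtain ⟨W, hW, hxW, hWU⟩ := hU.2 _ (Set.mem_smul_set_iff_inv_smul_mem.1 hx)
    exact ⟨π • W, smul_mem_finiteInters h𝓑 π hW, Set.mem_smul_set_iff_inv_smul_mem.2 hxW,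
      Set.smul_set_subset_smul_set_iff.2 hWU⟩
  sUnion := by
    intro 𝒰 hfs h
    rw [isFSUnion_iff (fun π _ => smul_mem_finiteInters h𝓑 π)]
    refine ⟨hfs.map (fun 𝒱 => ⋃₀ 𝒱) fun π => (smul_sUnion π 𝒰).symm, ?_⟩
    rintro x ⟨U, hU, hx⟩
    have hU' := h U hU
    rw [isFSUnion_iff (fun π _ => smul_mem_finiteInters h𝓑 π)] at hU'
    obtain ⟨W, hW, hxW, hWU⟩ := hU'.2 x hx
    exact ⟨W, hW, hxW, hWU.trans (Set.subset_sUnion_of_mem hU)⟩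
  inter := by
    intro U V hU hV
    rw [isFSUnion_iff (fun π _ => smul_mem_finiteInters h𝓑 π)] at hU hV ⊢
    refine ⟨hU.1.map₂ hV.1 (· ∩ ·) fun π => Set.smul_set_inter.symm, ?_⟩
    rintro x ⟨hxU, hxV⟩
    obtain ⟨W, ⟨F, hF, hFB, rfl⟩, hxW, hWU⟩ := hU.2 x hxU
    obtain ⟨W', ⟨F', hF', hFB', rfl⟩, hxW', hWV⟩ := hV.2 x hxV
    refine ⟨⋂₀ (F ∪ F'), ⟨F ∪ F', hF.union hF', Set.union_subset hFB hFB', rfl⟩, ?_, ?_⟩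
    · rw [Set.sInter_union]
      exact ⟨hxW, hxW'⟩
    · rw [Set.sInter_union]
      exact Set.inter_subset_inter hWU hWV
  univ := by
    rw [isFSUnion_iff (fun π _ => smul_mem_finiteInters h𝓑 π)]
    exact ⟨⟨∅, fun π _ => Set.smul_set_univ⟩,
      fun x _ => ⟨Set.univ, ⟨∅, Set.finite_empty, by simp, by simp⟩, trivial, subset_rfl⟩⟩

end Generate

/-- The discrete nominal topology: all finitely supported subsets are open. -/
def NomTop.discrete (A : Type v) (Y : Type u) [MulAction (FinPerm A) Y] : NomTop A Y where
  IsOpen := FinSupp A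
  finSupp _ h := h
  smul π _ h := h.smul π
  sUnion 𝒰 h _ := h.map (fun 𝒱 => ⋃₀ 𝒱) fun π => (smul_sUnion π 𝒰).symm
  inter _ _ hU hV := hU.map₂ hV (· ∩ ·) fun _ => Set.smul_set_inter.symm
  univ := ⟨∅, fun _ _ => Set.smul_set_univ⟩

namespace NomTop

variable {A : Type v} {X : Type u} [MulAction (FinPerm A) X]

theorem union (T : NomTop A X) {U V : Set X} (hU : T.IsOpen U) (hV : T.IsOpen V) :
    T.IsOpen (U ∪ V) := by
  rw [← Set.sUnion_pair]
  refine T.sUnion _ ((T.finSupp U hU).map₂ (T.finSupp V hV) (fun U V => ({U, V} : Set (Set X)))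
    fun π => (Set.image_pair _ _ _).symm) ?_
  rintro W (rfl | rfl)
  exacts [hU, hV]

/-- Continuity of (equivariant) maps. -/
def Continuous {Y : Type*} [MulAction (FinPerm A) Y] (T : NomTop A X) (T' : NomTop A Y)
    (f : X → Y) : Prop :=
  ∀ U, T'.IsOpen U → T.IsOpen (f ⁻¹' U)

/-- Isomorphisms of nominal topological spaces: equivariant homeomorphisms. -/
def IsIso {Y : Type*} [MulAction (FinPerm A) Y] (T : NomTop A X) (T' : NomTop A Y)
    (f : X ≃ Y) : Prop :=
  Equivariant A f ∧ T.Continuous T' f ∧ T'.Continuous T f.symm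

def IsClopen (T : NomTop A X) (C : Set X) : Prop := T.IsOpen C ∧ T.IsOpen Cᶜ

/-- The topological closure: the intersection of all closed supersets. -/
def closure (T : NomTop A X) (Z : Set X) : Set X := ⋂₀ {C | T.IsOpen Cᶜ ∧ Z ⊆ C}

/-- A basis: an equivariant set of open sets such that every open set is a finitely supported union
of finite intersections of members of `𝓑`, and every finite intersection of members of `𝓑` is a
finitely supported union of members of `𝓑`. -/
def IsBasis (T : NomTop A X) (𝓑 : Set (Set X)) : Prop :=
  (∀ R ∈ 𝓑, T.IsOpen R) ∧ (∀ (π : FinPerm A), ∀ R ∈ 𝓑, π • R ∈ 𝓑) ∧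
  (∀ U, T.IsOpen U → IsFSUnion A (finiteInters 𝓑) U) ∧
  (∀ W ∈ finiteInters 𝓑, IsFSUnion A 𝓑 W)

/-- Nominal compactness: every open cover has an orbit-finite subcover. -/
def IsCompact (T : NomTop A X) : Prop :=
  ∀ 𝒞 : Set (Set X), FinSupp A 𝒞 → (∀ U ∈ 𝒞, T.IsOpen U) → ⋃₀ 𝒞 = Set.univ →
    ∃ 𝒞' ⊆ 𝒞, OrbitFiniteSet A 𝒞' ∧ ⋃₀ 𝒞' = Set.univ

/-- The nominal Hausdorff property: for every finite `S`, points in different `S`-orbits have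
disjoint `S`-supported open neighbourhoods. -/
def IsHausdorff (T : NomTop A X) : Prop :=
  ∀ (S : Finset A) (x₁ x₂ : X), orbS S x₁ ≠ orbS S x₂ →
    ∃ U₁ U₂ : Set X, T.IsOpen U₁ ∧ T.IsOpen U₂ ∧
      MulAction.Supports (FinPerm A) (S : Set A) U₁ ∧
      MulAction.Supports (FinPerm A) (S : Set A) U₂ ∧
      Disjoint U₁ U₂ ∧ x₁ ∈ U₁ ∧ x₂ ∈ U₂

/-- Representable subsets: preimages of finitely supported subsets under continuous (equivariant)
maps to orbit-finite discrete spaces. (Restricting to `Y` in the universe of `X` is no loss, as `Y`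
can be replaced by the image of `X`.) -/
def IsRepresentable (T : NomTop A X) (R : Set X) : Prop :=
  ∃ (Y : Type u) (_ : MulAction (FinPerm A) Y) (f : X → Y) (P : Set Y),
    IsNominal A Y ∧ OrbitFinite A Y ∧ Equivariant A f ∧ T.Continuous (NomTop.discrete A Y) f ∧
    FinSupp A P ∧ R = f ⁻¹' P

/-- `k`-bounded nominal Stone spaces: `k`-bounded nominal sets with a compact Hausdorff nominal
topology that has a basis of representable sets. -/
structure IsKBoundedStone (k : ℕ) (T : NomTop A X) : Prop where
  nominal : IsNominal A X
  kBounded : IsKBounded A X k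
  compact : T.IsCompact
  hausdorff : T.IsHausdorff
  basis : ∃ 𝓑 : Set (Set X), T.IsBasis 𝓑 ∧ ∀ R ∈ 𝓑, T.IsRepresentable R

end NomTop

/-! ## Nominal boolean algebras -/

/-- The boolean operations of `B` are equivariant. -/
class IsEquivariantBA (A : Type v) (B : Type*) [BooleanAlgebra B] [MulAction (FinPerm A) B] :
    Prop where
  smul_sup : ∀ (π : FinPerm A) (x y : B), π • (x ⊔ y) = π • x ⊔ π • y
  smul_inf : ∀ (π : FinPerm A) (x y : B), π • (x ⊓ y) = π • x ⊓ π • y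
  smul_compl : ∀ (π : FinPerm A) (x : B), π • xᶜ = (π • x)ᶜ
  smul_bot : ∀ π : FinPerm A, π • (⊥ : B) = ⊥
  smul_top : ∀ π : FinPerm A, π • (⊤ : B) = ⊤

instance setIsEquivariantBA (A : Type v) (X : Type*) [MulAction (FinPerm A) X] :
    IsEquivariantBA A (Set X) where
  smul_sup _ _ _ := Set.smul_set_union
  smul_inf _ _ _ := Set.smul_set_inter
  smul_compl _ _ := Set.smul_set_compl
  smul_bot _ := Set.smul_set_empty
  smul_top _ := Set.smul_set_univ

/-- Equivariant boolean subalgebras. -/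
structure EqSubalg (A : Type v) (B : Type u) [BooleanAlgebra B] [MulAction (FinPerm A) B] where
  toSub : BooleanSubalgebra B
  smul_mem : ∀ (π : FinPerm A), ∀ b ∈ toSub, π • b ∈ toSub

/-- The elements of an equivariant boolean subalgebra, as an algebra in its own right. -/
def EqSubalg.El {A : Type v} {B : Type u} [BooleanAlgebra B] [MulAction (FinPerm A) B]
    (C : EqSubalg A B) : Type u := {b : B // b ∈ C.toSub}

section Algebras

variable {A : Type v} {B : Type u} [BooleanAlgebra B] [MulAction (FinPerm A) B]

instance (C : EqSubalg A B) : CoeOut C.El B := ⟨Subtype.val⟩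

instance (C : EqSubalg A B) : BooleanAlgebra C.El :=
  inferInstanceAs (BooleanAlgebra {b : B // b ∈ C.toSub})

instance (C : EqSubalg A B) : MulAction (FinPerm A) C.El where
  smul π b := ⟨π • b.1, C.smul_mem π b.1 b.2⟩
  one_smul b := Subtype.ext (one_smul _ b.1)
  mul_smul π σ b := Subtype.ext (mul_smul π σ b.1)

instance [IsEquivariantBA A B] (C : EqSubalg A B) : IsEquivariantBA A C.El where
  smul_sup π x y := Subtype.ext (IsEquivariantBA.smul_sup π x.1 y.1)
  smul_inf π x y := Subtype.ext (IsEquivariantBA.smul_inf π x.1 y.1)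
  smul_compl π x := Subtype.ext (IsEquivariantBA.smul_compl π x.1)
  smul_bot π := Subtype.ext (IsEquivariantBA.smul_bot π)
  smul_top π := Subtype.ext (IsEquivariantBA.smul_top π)

/-- `C` contains the suprema in `B` of its orbit-finite subsets. -/
def EqSubalg.ClosedUnderOFSup (C : EqSubalg A B) : Prop :=
  ∀ Y : Set B, (∀ y ∈ Y, y ∈ C.toSub) → OrbitFiniteSet A Y → ∀ b, IsLUB Y b → b ∈ C.toSub

variable (A B) in
/-- `B` is `k`-atomic: every element is the supremum of the atoms below it, and the set of atoms is
orbit-finite and `k`-bounded. -/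
def IsKAtomic (k : ℕ) : Prop :=
  (∀ b : B, IsLUB {a | IsAtom a ∧ a ≤ b} b) ∧ OrbitFiniteSet A {a : B | IsAtom a} ∧
    KBoundedSet A k {a : B | IsAtom a}

variable (A B) in
/-- Locally `k`-atomic orbit-finitely complete nominal boolean algebras. -/
structure IsLocallyKAtomicOFCBA (k : ℕ) : Prop where
  nominal : IsNominal A B
  equivariant : IsEquivariantBA A B
  complete : ∀ Y : Set B, OrbitFiniteSet A Y → ∃ b, IsLUB Y b
  locallyAtomic : ∀ b : B, ∃ C : EqSubalg A B,
    C.ClosedUnderOFSup ∧ IsKAtomic A C.El k ∧ b ∈ C.toSub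

variable (A) in
/-- Morphisms of orbit-finitely complete nominal boolean algebras: equivariant boolean homomorphisms
preserving suprema of orbit-finite subsets. -/
structure IsOFCHom {B' : Type*} [BooleanAlgebra B'] [MulAction (FinPerm A) B'] (f : B → B') :
    Prop where
  equivariant : Equivariant A f
  map_sup : ∀ x y, f (x ⊔ y) = f x ⊔ f y
  map_inf : ∀ x y, f (x ⊓ y) = f x ⊓ f y
  map_compl : ∀ x, f xᶜ = (f x)ᶜ
  map_bot : f ⊥ = ⊥
  map_top : f ⊤ = ⊤
  map_ofSup : ∀ (Y : Set B) (b : B), OrbitFiniteSet A Y → IsLUB Y b → IsLUB (f '' Y) (f b)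

variable (A) in
/-- Isomorphisms of orbit-finitely complete nominal boolean algebras. -/
def IsOFCIso {B' : Type*} [BooleanAlgebra B'] [MulAction (FinPerm A) B'] (f : B ≃ B') : Prop :=
  IsOFCHom A f ∧ IsOFCHom A f.symm

/-- Nominal orbit-finitely complete prime filters (with respect to the bound `k`). -/
structure IsPrimeFilter (A : Type v) {B : Type u} [BooleanAlgebra B] [MulAction (FinPerm A) B]
    (k : ℕ) (F : Set B) : Prop where
  finSupp : FinSupp A F
  nonempty : F.Nonempty
  upward : ∀ x y, x ∈ F → x ≤ y → y ∈ F
  inf_mem : ∀ x y, x ∈ F → y ∈ F → x ⊓ y ∈ F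
  prime : ∀ (Y : Set B) (b : B), OrbitFiniteSet A Y → KBoundedSet A k Y → IsLUB Y b → b ∈ F →
    (Y ∩ F).Nonempty

theorem smul_le_smul_iff_ba [IsEquivariantBA A B] (π : FinPerm A) {x y : B} :
    π • x ≤ π • y ↔ x ≤ y := by
  rw [← inf_eq_left, ← IsEquivariantBA.smul_inf, smul_left_cancel_iff, inf_eq_left]

theorem isLUB_smul [IsEquivariantBA A B] (π : FinPerm A) {Y : Set B} {b : B} (h : IsLUB Y b) :
    IsLUB (π • Y) (π • b) := by
  constructor
  · rintro _ ⟨y, hy, rfl⟩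
    exact (smul_le_smul_iff_ba π).2 (h.1 hy)
  · intro c hc
    rw [← smul_inv_smul π c, smul_le_smul_iff_ba]
    refine h.2 fun y hy => ?_
    rw [← smul_le_smul_iff_ba π, smul_inv_smul]
    exact hc ⟨y, hy, rfl⟩

theorem supports_smul_iff {X : Type*} [MulAction (FinPerm A) X] (π : FinPerm A) (S : Set A)
    (x : X) : MulAction.Supports (FinPerm A) (π • S) (π • x) ↔
      MulAction.Supports (FinPerm A) S x := by
  have key : ∀ {σ : FinPerm A} {T : Set A} {y : X}, MulAction.Supports (FinPerm A) T y →
      MulAction.Supports (FinPerm A) (σ • T) (σ • y) := by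
    intro σ T y hT ρ hρ
    have h : (σ⁻¹ * ρ * σ) • y = y := hT _ fun a ha => by
      rw [mul_smul, mul_smul, hρ (Set.smul_mem_smul_set ha), inv_smul_smul]
    rw [mul_smul, mul_smul, inv_smul_eq_iff] at h
    exact h
  refine ⟨fun h => ?_, key⟩
  simpa using key (σ := π⁻¹) h

theorem supp_smul {X : Type*} [MulAction (FinPerm A) X] (π : FinPerm A) (x : X) :
    supp A (π • x) = π • supp A x := by
  ext a
  rw [Set.mem_smul_set_iff_inv_smul_mem]
  simp only [supp, Set.mem_sInter]
  constructor
  · rintro h S ⟨hS, hSx⟩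
    exact Set.mem_smul_set_iff_inv_smul_mem.1
      (h (π • S) ⟨hS.image _, (supports_smul_iff π S x).2 hSx⟩)
  · rintro h S ⟨hS, hSx⟩
    have := h (π⁻¹ • S) ⟨hS.image _, by
      rw [← supports_smul_iff π, smul_inv_smul]
      exact hSx⟩
    simpa [Set.mem_smul_set_iff_inv_smul_mem] using this

theorem KBoundedSet.smul {X : Type*} [MulAction (FinPerm A) X] {k : ℕ} {Y : Set X}
    (h : KBoundedSet A k Y) (π : FinPerm A) : KBoundedSet A k (π • Y) := by
  rintro _ ⟨y, hy, rfl⟩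
  change (supp A (π • y)).encard ≤ k
  rw [supp_smul]
  change ((fun a => π • a) '' supp A y).encard ≤ k
  rw [(MulAction.injective π).encard_image]
  exact h y hy

theorem OrbitFiniteSet.smul {X : Type*} [MulAction (FinPerm A) X] {Y : Set X}
    (h : OrbitFiniteSet A Y) (π : FinPerm A) : OrbitFiniteSet A (π • Y) := by
  refine ⟨h.1.smul π, h.2.subset ?_⟩
  rintro _ ⟨_, ⟨y, hy, rfl⟩, rfl⟩
  exact ⟨y, hy, (MulAction.orbit_smul π y).symm⟩

theorem IsPrimeFilter.smul [IsEquivariantBA A B] {k : ℕ} {F : Set B} (h : IsPrimeFilter A k F)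
    (π : FinPerm A) : IsPrimeFilter A k (π • F) where
  finSupp := h.finSupp.smul π
  nonempty := h.nonempty.smul_set
  upward x y hx hxy := by
    rw [Set.mem_smul_set_iff_inv_smul_mem] at hx ⊢
    exact h.upward _ _ hx ((smul_le_smul_iff_ba π⁻¹).2 hxy)
  inf_mem x y hx hy := by
    rw [Set.mem_smul_set_iff_inv_smul_mem] at hx hy ⊢
    rw [IsEquivariantBA.smul_inf]
    exact h.inf_mem _ _ hx hy
  prime Y b hY hk hb hbF := by
    rw [Set.mem_smul_set_iff_inv_smul_mem] at hbF
    obtain ⟨y, hy, hyF⟩ := h.prime (π⁻¹ • Y) (π⁻¹ • b) (hY.smul _) (hk.smul _) (isLUB_smul _ hb) hbF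
    exact ⟨π • y, by simpa [Set.mem_smul_set_iff_inv_smul_mem] using hy,
      Set.smul_mem_smul_set hyF⟩

variable (A B) in
/-- The set `F_p(B)` of nominal orbit-finitely complete prime filters. -/
def PrimeFilters (k : ℕ) : Type u := {F : Set B // IsPrimeFilter A k F}

instance [IsEquivariantBA A B] (k : ℕ) : MulAction (FinPerm A) (PrimeFilters A B k) where
  smul π F := ⟨π • F.1, F.2.smul π⟩
  one_smul F := Subtype.ext (one_smul _ F.1)
  mul_smul π σ F := Subtype.ext (mul_smul π σ F.1)

variable (A B) in
/-- The topology on `F_p(B)`, generated by the sets `{F | b ∈ F}`, `b ∈ B`. -/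
def primeFilterTop [IsEquivariantBA A B] (k : ℕ) : NomTop A (PrimeFilters A B k) :=
  NomTop.generate {W | ∃ b : B, W = {F | b ∈ F.1}} (by
    rintro π _ ⟨b, rfl⟩
    refine ⟨π • b, ?_⟩
    ext F
    rw [Set.mem_smul_set_iff_inv_smul_mem]
    change b ∈ π⁻¹ • F.1 ↔ π • b ∈ F.1
    rw [Set.mem_inv_smul_set_iff])

end Algebras

/-- The algebra `Clo(X)` of clopen sets of a nominal topological space. -/
def cloAlg {A : Type v} {X : Type u} [MulAction (FinPerm A) X] (T : NomTop A X) :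
    EqSubalg A (Set X) where
  toSub :=
    { carrier := {C | T.IsClopen C}
      supClosed' := by
        rintro C ⟨hC, hC'⟩ D ⟨hD, hD'⟩
        refine ⟨T.union hC hD, ?_⟩
        change T.IsOpen (C ∪ D)ᶜ
        rw [Set.compl_union]
        exact T.inter _ _ hC' hD'
      infClosed' := by
        rintro C ⟨hC, hC'⟩ D ⟨hD, hD'⟩
        refine ⟨T.inter _ _ hC hD, ?_⟩
        change T.IsOpen (C ∩ D)ᶜ
        rw [Set.compl_inter]
        exact T.union hC' hD'
      compl_mem' := fun {C} h => ⟨h.2, by rw [compl_compl]; exact h.1⟩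
      bot_mem' := ⟨by
        have := T.sUnion ∅ ⟨∅, fun _ _ => Set.smul_set_empty⟩ (by simp)
        simpa using this, by
        change T.IsOpen (∅ : Set X)ᶜ
        rw [Set.compl_empty]
        exact T.univ⟩ }
  smul_mem π C h := ⟨T.smul π _ h.1, by rw [← Set.smul_set_compl]; exact T.smul π _ h.2⟩

/-! ## Words, recognizable languages, pro-orbit-finite words -/

section Words

variable {A : Type v} {Al : Type u} [MulAction (FinPerm A) Al]

/-- The letterwise action on words. -/
instance wordAction : MulDistribMulAction (FinPerm A) (FreeMonoid Al) where
  smul π w := FreeMonoid.map (fun a => π • a) w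
  one_smul w := by
    change FreeMonoid.map (fun a => (1 : FinPerm A) • a) w = w
    simp only [one_smul]
    exact DFunLike.congr_fun FreeMonoid.map_id w
  mul_smul π σ w := by
    change FreeMonoid.map (fun a => (π * σ) • a) w =
      FreeMonoid.map (fun a => π • a) (FreeMonoid.map (fun a => σ • a) w)
    simp only [mul_smul]
    exact (FreeMonoid.map_map (g := fun a : Al => σ • a) (f := fun a : Al => π • a)).symm
  smul_mul π := map_mul (FreeMonoid.map fun a => π • a)
  smul_one π := map_one (FreeMonoid.map fun a => π • a)

/-- `s`-bounded maps on words: `supp (h w) ⊆ s w` for all words `w`. -/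
def SBounded {M : Type*} [MulAction (FinPerm A) M] (s : FreeMonoid Al → Finset A)
    (h : FreeMonoid Al → M) : Prop :=
  ∀ w, supp A (h w) ⊆ s w

/-- `L` is `s`-recognizable: `L = h⁻¹[P]` for an `s`-bounded equivariant monoid morphism `h` to an
orbit-finite nominal monoid `M` and a finitely supported `P ⊆ M`. (Restricting to `M` in the
universe of the alphabet is no loss, as `M` can be replaced by the image of `h`.) -/
def SRecognizable (s : FreeMonoid Al → Finset A) (L : Set (FreeMonoid Al)) : Prop :=
  ∃ (M : Type u) (_ : Monoid M) (_ : MulDistribMulAction (FinPerm A) M)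
    (h : FreeMonoid Al →* M) (P : Set M),
    IsNominal A M ∧ OrbitFinite A M ∧ Equivariant A h ∧ SBounded s h ∧ FinSupp A P ∧ L = h ⁻¹' P

/-- The algebra `Rec_s` of `s`-recognizable languages. -/
def recAlg [Infinite A] (s : FreeMonoid Al → Finset A) : EqSubalg A (Set (FreeMonoid Al)) where
  toSub :=
    have hcompl : ∀ L : Set (FreeMonoid Al), SRecognizable s L → SRecognizable s Lᶜ := by
      rintro _ ⟨M, _, _, h, P, hM, hof, hh, hs, hP, rfl⟩
      exact ⟨M, _, _, h, Pᶜ, hM, hof, hh, hs, hP.map (fun P => Pᶜ) fun π =>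
        Set.smul_set_compl.symm, rfl⟩
    have hsup : ∀ L L' : Set (FreeMonoid Al), SRecognizable s L → SRecognizable s L' →
        SRecognizable s (L ∪ L') := by
      rintro _ _ ⟨M, _, _, h, P, hM, hof, hh, hs, hP, rfl⟩
        ⟨M', _, _, h', P', hM', hof', hh', hs', hP', rfl⟩
      refine ⟨M × M', inferInstance, inferInstance, h.prod h',
        (Prod.fst ⁻¹' P) ∪ (Prod.snd ⁻¹' P'), fun x => ?_, hof.prod hM hM' hof', fun π w => ?_,
        fun w => ?_, ?_, rfl⟩
      · exact (hM x.1).map₂ (hM' x.2) Prod.mk fun π => rfl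
      · exact Prod.ext (hh π w) (hh' π w)
      · have h1 := (supp_subset_iff (hM (h w)) (s w)).1 (hs w)
        have h2 := (supp_subset_iff (hM' (h' w)) (s w)).1 (hs' w)
        exact Set.sInter_subset_of_mem ⟨(s w).finite_toSet, fun π hπ =>
          Prod.ext (h1 π hπ) (h2 π hπ)⟩
      · refine hP.map₂ hP' (fun P P' => (Prod.fst ⁻¹' P) ∪ (Prod.snd ⁻¹' P')) fun π => ?_
        rw [Set.smul_set_union, smul_preimage (f := Prod.fst) (fun _ _ => rfl),
          smul_preimage (f := Prod.snd) (fun _ _ => rfl)]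
    { carrier := {L | SRecognizable s L}
      supClosed' := fun L hL L' hL' => hsup L L' hL hL'
      infClosed' := fun L hL L' hL' => by
        have h := hcompl _ (hsup _ _ (hcompl _ hL) (hcompl _ hL'))
        rw [Set.compl_union, compl_compl, compl_compl] at h
        exact h
      compl_mem' := fun {L} hL => hcompl L hL
      bot_mem' := by
        refine ⟨PUnit, inferInstance,
          { smul := fun _ x => x, one_smul := fun _ => rfl, mul_smul := fun _ _ _ => rfl,
            smul_mul := fun _ _ _ => rfl, smul_one := fun _ => rfl },
          1, ∅, fun x => ⟨∅, fun _ _ => rfl⟩, ?_, fun _ _ => rfl, fun w => ?_,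
          ⟨∅, fun _ _ => Set.smul_set_empty⟩, rfl⟩
        · unfold OrbitFinite
          infer_instance
        · exact Set.sInter_subset_of_mem ⟨(s w).finite_toSet, fun _ _ => rfl⟩ }
  smul_mem π L hL := by
    obtain ⟨M, _, _, h, P, hM, hof, hh, hs, hP, rfl⟩ := hL
    exact ⟨M, _, _, h, π • P, hM, hof, hh, hs, hP.smul π, smul_preimage hh π P⟩

/-- Equivariant congruences on the free monoid. -/
structure EqCon (A : Type v) (Al : Type u) [MulAction (FinPerm A) Al] where
  con : Con (FreeMonoid Al)
  smul : ∀ (π : FinPerm A) u v, con u v → con (π • u) (π • v)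

/-- The quotient monoid, with the induced action. -/
def EqCon.Q (c : EqCon A Al) : Type u := c.con.Quotient

instance (c : EqCon A Al) : Monoid c.Q := inferInstanceAs (Monoid c.con.Quotient)

/-- The quotient morphism. -/
def EqCon.proj (c : EqCon A Al) : FreeMonoid Al →* c.Q := c.con.mk'

theorem EqCon.proj_surjective (c : EqCon A Al) : Function.Surjective c.proj := Con.mk'_surjective

instance (c : EqCon A Al) : MulDistribMulAction (FinPerm A) c.Q where
  smul π := c.con.lift (c.proj.comp (MulDistribMulAction.toMonoidHom _ π))
    fun u v h => (Con.eq c.con).2 (c.smul π u v h)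
  one_smul x := by
    obtain ⟨w, rfl⟩ := c.proj_surjective x
    exact congrArg c.proj (one_smul _ w)
  mul_smul π σ x := by
    obtain ⟨w, rfl⟩ := c.proj_surjective x
    exact congrArg c.proj (mul_smul π σ w)
  smul_mul π x y := map_mul (c.con.lift _ _) x y
  smul_one π := map_one (c.con.lift _ _)

theorem EqCon.proj_smul (c : EqCon A Al) (π : FinPerm A) (w : FreeMonoid Al) :
    c.proj (π • w) = π • c.proj w := rfl

/-- The poset of `s`-bounded quotient monoids of the free monoid with `k`-bounded orbit-finite
codomain; quotients are represented by their kernels, so that `e'` factorizes through `e` iff the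
kernel of `e` is contained in that of `e'`. -/
structure SQuot (s : FreeMonoid Al → Finset A) (k : ℕ) extends EqCon A Al where
  nominal : IsNominal A toEqCon.Q
  orbitFinite : OrbitFinite A toEqCon.Q
  kBounded : IsKBounded A toEqCon.Q k
  sBounded : SBounded s toEqCon.proj

/-- The connecting morphism between two quotients. -/
def EqCon.conn (c d : EqCon A Al) (h : c.con ≤ d.con) : c.Q →* d.Q := Con.map c.con d.con h

theorem EqCon.conn_smul (c d : EqCon A Al) (h : c.con ≤ d.con) (π : FinPerm A) (x : c.Q) :
    c.conn d h (π • x) = π • c.conn d h x := by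
  obtain ⟨w, rfl⟩ := c.proj_surjective x
  rfl

/-- The set of `s`-bounded pro-orbit-finite words: the limit of the diagram of all `s`-bounded
`k`-bounded orbit-finite quotient monoids, i.e. the set of compatible families. -/
def ProWords (s : FreeMonoid Al → Finset A) (k : ℕ) : Type u :=
  {x : ∀ c : SQuot s k, c.Q //
    ∀ (c d : SQuot s k) (h : c.con ≤ d.con), c.conn d.toEqCon h (x c) = x d}

variable {s : FreeMonoid Al → Finset A} {k : ℕ}

instance : MulAction (FinPerm A) (ProWords s k) where
  smul π x := ⟨fun c => π • x.1 c, fun c d h =>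
    (c.conn_smul d.toEqCon h π (x.1 c)).trans (congrArg (π • ·) (x.2 c d h))⟩
  one_smul _ := Subtype.ext (funext fun _ => one_smul _ _)
  mul_smul π σ _ := Subtype.ext (funext fun _ => mul_smul π σ _)

variable (s k) in
/-- The initial topology on the limit, generated by the preimages of the (finitely supported)
subsets of the discrete spaces in the diagram. -/
def proWordsTop : NomTop A (ProWords s k) :=
  NomTop.generate
    {W | ∃ (c : SQuot s k) (U : Set c.Q), FinSupp A U ∧ W = {x : ProWords s k | x.1 c ∈ U}} (by
    rintro π _ ⟨c, U, hU, rfl⟩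
    exact ⟨c, π • U, hU.smul π,
      smul_preimage (f := fun x : ProWords s k => x.1 c) (fun _ _ => rfl) π U⟩)

variable (s k) in
/-- The canonical map from words to pro-orbit-finite words. -/
def eta (w : FreeMonoid Al) : ProWords s k := ⟨fun c => c.proj w, fun _ _ _ => rfl⟩

end Words

end NominalStone

open NominalStone

/-! The `s`-bounded quotients form a codirected diagram. The product of two of them need not be
`k`-bounded, but the image of the words in it is: the image of `w` is supported by `s w`, which has
at most `k` names (`SQuot.exists_le_le`). Everything below plays off codirectedness against the
uniform bound `k`.

Supports can only grow along refinements and never exceed `k` names, so the support of a point of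
the limit is already reached at one coordinate (`ProWords.exists_supp_eq`). Hence the limit is
nominal and `k`-bounded. For compactness, fix `k` names outside the support of the cover. Every
element of every quotient can be moved, fixing that support, to one supported by it and these `k`
names, and an orbit-finite set has only finitely many such elements. So the usual argument with
inverse limits of finite nonempty sets applies and refines any cover by the fibres of one projection
(`proWordsTop_exists_fibre_subset`). The Hausdorff property is another finiteness argument, based on
stabilised supports.

Applied to the cover by a clopen set and its complement, the refinement shows that clopen sets are
exactly the preimages of finitely supported subsets of a single quotient. Recognizable languages
have the same description with words in place of points. Both algebras are therefore instances of
`IsSaturationAlgebra`, which yields completeness and local atomicity: finitely many orbits of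
members live at one stage, joins are unions, and the nonempty fibres are the atoms. By density of
the words, closure sends the preimage of `P` among words to the preimage of `P` among points
(`closure_eta_image`). This gives the algebra isomorphism.

A prime filter contains some fibre at each stage, since the fibres form an orbit-finite `k`-bounded
family with join `⊤`. The chosen fibres form a compatible family, that is, a point (`exists_point`).
The Stone property of the prime filter space is then transported from the limit. -/

namespace NominalStone

/-! ### Equivariant maps, supports and orbit-finiteness -/

section Supports

variable {A : Type v} {X Y : Type*} [MulAction (FinPerm A) X] [MulAction (FinPerm A) Y]

theorem Equivariant.supports {f : X → Y} (hf : Equivariant A f) {S : Set A} {x : X}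
    (h : MulAction.Supports (FinPerm A) S x) : MulAction.Supports (FinPerm A) S (f x) :=
  fun π hπ => by rw [← hf, h π hπ]

theorem Equivariant.finSupp {f : X → Y} (hf : Equivariant A f) {x : X} (h : FinSupp A x) :
    FinSupp A (f x) := h.map f fun π => hf π x

theorem Equivariant.supports_iff {f : X → Y} (hf : Equivariant A f) (hinj : Function.Injective f)
    {S : Set A} {x : X} :
    MulAction.Supports (FinPerm A) S (f x) ↔ MulAction.Supports (FinPerm A) S x :=
  ⟨fun h π hπ => hinj (by rw [hf, h π hπ]), hf.supports⟩

theorem Equivariant.finSupp_iff {f : X → Y} (hf : Equivariant A f) (hinj : Function.Injective f)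
    {x : X} : FinSupp A (f x) ↔ FinSupp A x :=
  exists_congr fun _ => hf.supports_iff hinj

theorem Equivariant.supp_eq {f : X → Y} (hf : Equivariant A f) (hinj : Function.Injective f)
    (x : X) : supp A (f x) = supp A x := by
  simp only [supp, hf.supports_iff hinj]

theorem Equivariant.supp_subset {f : X → Y} (hf : Equivariant A f) (x : X) :
    supp A (f x) ⊆ supp A x :=
  Set.sInter_subset_sInter fun _ hS => ⟨hS.1, hf.supports hS.2⟩

theorem Equivariant.symm {f : X ≃ Y} (hf : Equivariant A f) : Equivariant A f.symm := fun π y => by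
  rw [Equiv.symm_apply_eq, hf, Equiv.apply_symm_apply]

theorem Equivariant.orbitFinite {f : X → Y} (hf : Equivariant A f) (hinj : Function.Injective f)
    (hY : OrbitFinite A Y) : OrbitFinite A X := by
  have : Finite (MulAction.orbitRel.Quotient (FinPerm A) Y) := hY
  have hrel : ∀ x x' : X, MulAction.orbitRel (FinPerm A) X x x' →
      MulAction.orbitRel (FinPerm A) Y (f x) (f x') := by
    rintro _ x' ⟨π, rfl⟩
    exact ⟨π, (hf π x').symm⟩
  refine Finite.of_injective (Quotient.map' (s₁ := MulAction.orbitRel (FinPerm A) X)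
    (s₂ := MulAction.orbitRel (FinPerm A) Y) f hrel) ?_
  intro p q
  induction p using Quotient.inductionOn' with | _ x
  induction q using Quotient.inductionOn' with | _ y
  intro h
  obtain ⟨π, hπ⟩ := Quotient.exact' h
  exact Quotient.sound' ⟨π, hinj (by rw [hf]; exact hπ)⟩

theorem supports_coe_inv {S : Finset A} {π : FinPerm A} (hπ : ∀ a ∈ S, π • a = a) :
    ∀ a ∈ S, π⁻¹ • a = a := fun a ha => by rw [inv_smul_eq_iff, hπ a ha]

theorem supports_orbS (S : Finset A) (x : X) :
    MulAction.Supports (FinPerm A) (S : Set A) (orbS S x) := by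
  intro π hπ
  ext y
  rw [Set.mem_smul_set_iff_inv_smul_mem]
  constructor
  · rintro ⟨ρ, hρ, h⟩
    exact ⟨π * ρ, fun a ha => by rw [mul_smul, hρ a ha]; exact hπ ha,
      by rw [mul_smul, h, smul_inv_smul]⟩
  · rintro ⟨ρ, hρ, rfl⟩
    exact ⟨π⁻¹ * ρ, fun a ha => by
      rw [mul_smul, hρ a ha]; exact supports_coe_inv (fun b hb => hπ (a := b) hb) a ha,
      mul_smul _ _ _⟩

theorem mem_orbS_self (S : Finset A) (x : X) : x ∈ orbS S x := ⟨1, fun _ _ => rfl, one_smul _ _⟩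

theorem orbS_eq_of_mem {S : Finset A} {x y : X} (h : y ∈ orbS S x) : orbS S y = orbS S x := by
  obtain ⟨π, hπ, rfl⟩ := h
  ext z
  constructor
  · rintro ⟨ρ, hρ, rfl⟩
    exact ⟨ρ * π, fun a ha => by rw [mul_smul, hπ a ha, hρ a ha], mul_smul _ _ _⟩
  · rintro ⟨ρ, hρ, rfl⟩
    exact ⟨ρ * π⁻¹, fun a ha => by rw [mul_smul, supports_coe_inv hπ a ha, hρ a ha],
      by rw [mul_smul, inv_smul_smul]⟩

/-- An element supported by `F` is fixed by every permutation fixing `F`, so it must itself occur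
among the finitely many representatives of the `F`-orbits. -/
theorem finite_orbit_inter_supports [Infinite A] (F : Finset A) {x : X} (hx : FinSupp A x) :
    {y | y ∈ MulAction.orbit (FinPerm A) x ∧
      MulAction.Supports (FinPerm A) (F : Set A) y}.Finite := by
  obtain ⟨R, hR, h⟩ := exists_finite_orbS_reps F hx
  refine hR.subset ?_
  rintro _ ⟨⟨σ, rfl⟩, hF⟩
  obtain ⟨π, hπ, hmem⟩ := h σ
  have : π • σ • x = σ • x := hF π fun a ha => hπ a ha
  rwa [this] at hmem

/-- An orbit-finite nominal set has only finitely many elements with a given finite support. -/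
theorem OrbitFinite.finite_supports [Infinite A] (hX : IsNominal A X) (hof : OrbitFinite A X)
    (F : Finset A) : {x : X | MulAction.Supports (FinPerm A) (F : Set A) x}.Finite := by
  have : Finite (MulAction.orbitRel.Quotient (FinPerm A) X) := hof
  refine (Set.finite_iUnion fun i : MulAction.orbitRel.Quotient (FinPerm A) X =>
    finite_orbit_inter_supports F (hX (Quotient.out i))).subset fun x hx => ?_
  refine Set.mem_iUnion.2 ⟨Quotient.mk'' x, ?_, hx⟩
  have h := Quotient.mk_out (s := MulAction.orbitRel (FinPerm A) X) x
  exact MulAction.orbitRel_apply.1 (Setoid.symm' _ h)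

theorem exists_fresh_finset [Infinite A] (S : Finset A) (k : ℕ) :
    ∃ D : Finset A, D.card = k ∧ Disjoint S D := by
  obtain ⟨D, hD, hk⟩ := (Finset.finite_toSet S).infinite_compl.exists_subset_card_eq k
  exact ⟨D, hk, Finset.disjoint_left.2 fun a ha haD => hD haD ha⟩

/-- An element with support of size at most `k` can be moved, fixing `S`, to an element supported
by `S` together with `k` given further names. -/
theorem exists_smul_supports [Infinite A] {k : ℕ} {x : X} (hx : FinSupp A x)
    (hk : (supp A x).encard ≤ k) {S D : Finset A} (hD : D.card = k) (hSD : Disjoint S D) :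
    ∃ π : FinPerm A, (∀ a ∈ S, π • a = a) ∧
      MulAction.Supports (FinPerm A) ((S : Set A) ∪ D) (π • x) := by
  classical
  obtain ⟨hfin, hsupp⟩ := supports_supp hx
  have hTD : hfin.toFinset.card ≤ D.card := by
    rw [hD]
    rw [hfin.encard_eq_coe_toFinset_card] at hk
    exact_mod_cast hk
  obtain ⟨j, hjD, hj⟩ := Finset.exists_subset_card_eq hTD
  let e := Finset.equivOfCardEq hj.symm
  -- `g` is the identity on `S` and sends the rest of the support into `D`; it is injective because
  -- `S` and `D` are disjoint.
  let g : A → A := fun a => if a ∈ S then a else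
    if h : a ∈ hfin.toFinset then (e ⟨a, h⟩ : A) else a
  have hgS : ∀ a ∈ S, g a = a := fun a ha => if_pos ha
  have hgT : ∀ a (_ : a ∉ S) (h : a ∈ hfin.toFinset), g a = (e ⟨a, h⟩ : A) := fun a ha h => by
    simp only [g, if_neg ha, dif_pos h]
  have hgD : ∀ a (_ : a ∉ S) (_ : a ∈ hfin.toFinset), g a ∈ D := fun a ha h => by
    rw [hgT a ha h]
    exact hjD (e ⟨a, h⟩).2
  obtain ⟨π, hπ⟩ := exists_perm_extending (S ∪ hfin.toFinset) g (by
    intro a ha b hb hab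
    have ha' : a ∈ S ∪ hfin.toFinset := ha
    have hb' : b ∈ S ∪ hfin.toFinset := hb
    rw [Finset.mem_union] at ha' hb'
    by_cases haS : a ∈ S <;> by_cases hbS : b ∈ S
    · rwa [hgS a haS, hgS b hbS] at hab
    · rw [hgS a haS] at hab
      exact absurd (hab ▸ hgD b hbS (hb'.resolve_left hbS)) (Finset.disjoint_left.1 hSD haS)
    · rw [hgS b hbS] at hab
      exact absurd (hab ▸ hgD a haS (ha'.resolve_left haS)) (Finset.disjoint_left.1 hSD hbS)
    · rw [hgT a haS (ha'.resolve_left haS), hgT b hbS (hb'.resolve_left hbS)] at hab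
      exact congrArg Subtype.val (e.injective (Subtype.ext hab)))
  refine ⟨π, fun a ha => by rw [hπ a (Finset.mem_union_left _ ha), hgS a ha], ?_⟩
  refine ((supports_smul_iff π _ x).2 hsupp).mono ?_
  rintro _ ⟨a, ha, rfl⟩
  have haT : a ∈ hfin.toFinset := hfin.mem_toFinset.2 ha
  change π • a ∈ _
  rw [hπ a (Finset.mem_union_right _ haT)]
  by_cases haS : a ∈ S
  · rw [hgS a haS]
    exact Or.inl haS
  · exact Or.inr (hgD a haS haT)

theorem OrbitFiniteSet.of_reps {Y : Set X} (hY : FinSupp A Y) {R : Set X} (hR : R.Finite)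
    (h : ∀ y ∈ Y, ∃ π : FinPerm A, π • y ∈ R) : OrbitFiniteSet A Y := by
  refine ⟨hY, (hR.image (MulAction.orbit (FinPerm A))).subset ?_⟩
  rintro _ ⟨y, hy, rfl⟩
  obtain ⟨π, hπ⟩ := h y hy
  exact ⟨_, hπ, MulAction.orbit_smul π y⟩

theorem OrbitFiniteSet.exists_reps {Y : Set X} (hY : OrbitFiniteSet A Y) :
    ∃ R ⊆ Y, R.Finite ∧ ∀ y ∈ Y, ∃ r ∈ R, ∃ π : FinPerm A, π • r = y := by
  obtain ⟨R, hRY, hR, hRo⟩ := Set.exists_subset_image_finite_and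
    (p := fun T => T = MulAction.orbit (FinPerm A) '' Y) |>.1 ⟨_, subset_rfl, hY.2, rfl⟩
  refine ⟨R, hRY, hR, fun y hy => ?_⟩
  obtain ⟨r, hr, hry⟩ := hRo.symm.subset (Set.mem_image_of_mem _ hy)
  have : y ∈ MulAction.orbit (FinPerm A) r := hry ▸ MulAction.mem_orbit_self y
  exact ⟨r, hr, this⟩

end Supports

/-! ### Generated topologies and transport along homeomorphisms -/

section Topology

variable {A : Type v} {X Y : Type u} [MulAction (FinPerm A) X] [MulAction (FinPerm A) Y]

theorem smul_preimage_set {X Y : Type*} [MulAction (FinPerm A) X] [MulAction (FinPerm A) Y]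
    {f : X → Y} (hf : Equivariant A f) : Equivariant A (fun P : Set Y => f ⁻¹' P) :=
  fun π P => (smul_preimage hf π P).symm

theorem smul_image_set {X Y : Type*} [MulAction (FinPerm A) X] [MulAction (FinPerm A) Y]
    {f : X → Y} (hf : Equivariant A f) : Equivariant A (fun P : Set X => f '' P) := by
  intro π P
  exact Set.image_smul_comm f π P fun x => hf π x

theorem NomTop.generate_isOpen_of_mem {𝓑 : Set (Set X)} (h𝓑 : ∀ π : FinPerm A, ∀ W ∈ 𝓑, π • W ∈ 𝓑)
    {W : Set X} (hW : W ∈ 𝓑) (hfs : FinSupp A W) : (NomTop.generate 𝓑 h𝓑).IsOpen W :=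
  (isFSUnion_iff (fun π _ => smul_mem_finiteInters h𝓑 π) W).2
    ⟨hfs, fun _ hx => ⟨W, ⟨{W}, Set.finite_singleton W, by simpa using hW, by simp⟩, hx, subset_rfl⟩⟩

/-- Preimages commute with unions and finite intersections. Equivariance of `f` is what keeps the
family of preimages finitely supported, so that its union is open. -/
theorem NomTop.continuous_generate {Z : Type*} [MulAction (FinPerm A) Z] (T : NomTop A X)
    {𝓑 : Set (Set Z)}
    (h𝓑 : ∀ π : FinPerm A, ∀ W ∈ 𝓑, π • W ∈ 𝓑) {f : X → Z} (hf : Equivariant A f)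
    (h : ∀ W ∈ 𝓑, T.IsOpen (f ⁻¹' W)) : T.Continuous (NomTop.generate 𝓑 h𝓑) f := by
  have hfin : ∀ F : Set (Set Z), F.Finite → F ⊆ 𝓑 → T.IsOpen (f ⁻¹' ⋂₀ F) := by
    intro F hF
    induction F, hF using Set.Finite.induction_on with
    | empty => intro _; simpa using T.univ
    | @insert W F _ _ ih =>
      intro hsub
      rw [Set.sInter_insert, Set.preimage_inter]
      exact T.inter _ _ (h W (hsub (Set.mem_insert _ _)))
        (ih ((Set.subset_insert _ _).trans hsub))
  rintro _ ⟨𝒰, hfs, hsub, rfl⟩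
  rw [Set.preimage_sUnion, ← Set.sUnion_image]
  refine T.sUnion _ ((smul_image_set (smul_preimage_set hf)).finSupp hfs) ?_
  rintro _ ⟨W, hW, rfl⟩
  obtain ⟨F, hF, hFB, rfl⟩ := hsub hW
  exact hfin F hF hFB

/-- Lets the prime filter space inherit the Stone property from the limit instead of being analysed
directly. -/
theorem isKBoundedStone_of_isIso [Infinite A] {T : NomTop A X} {T' : NomTop A Y} {f : X ≃ Y}
    (hf : T.IsIso T' f) {k : ℕ} (hT : T.IsKBoundedStone k) : T'.IsKBoundedStone k := by
  obtain ⟨hfe, hfc, hfo⟩ := hf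
  have hge := hfe.symm
  have hpre : Equivariant A (fun P : Set X => f.symm ⁻¹' P) := smul_preimage_set hge
  have hpre' : Equivariant A (fun P : Set Y => f ⁻¹' P) := smul_preimage_set hfe
  have hfg : ∀ U : Set X, f ⁻¹' (f.symm ⁻¹' U) = U := fun U => by
    rw [← Set.preimage_comp, Equiv.symm_comp_self, Set.preimage_id]
  have hgf : ∀ U : Set Y, f.symm ⁻¹' (f ⁻¹' U) = U := fun U => by
    rw [← Set.preimage_comp, Equiv.self_comp_symm, Set.preimage_id]
  refine ⟨fun y => ?_, fun y _ => ?_, ?_, ?_, ?_⟩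
  · exact (hge.finSupp_iff f.symm.injective).1 (hT.nominal _)
  · rw [← hge.supp_eq f.symm.injective]
    exact hT.kBounded _ trivial
  · intro 𝒞 hfs hop hcov
    obtain ⟨𝒞', hsub, hof, hcov'⟩ := hT.compact ((fun P : Set Y => f ⁻¹' P) '' 𝒞)
      ((smul_image_set hpre').finSupp hfs) (by
        rintro _ ⟨U, hU, rfl⟩
        exact hfc U (hop U hU)) (by
        rw [Set.sUnion_image, ← Set.preimage_sUnion, hcov, Set.preimage_univ])
    refine ⟨(fun P : Set X => f.symm ⁻¹' P) '' 𝒞', ?_, ⟨(smul_image_set hpre).finSupp hof.1, ?_⟩, ?_⟩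
    · rintro _ ⟨U, hU, rfl⟩
      obtain ⟨V, hV, rfl⟩ := hsub hU
      simpa only [hgf] using hV
    · refine (hof.2.image fun 𝒪 => (fun P : Set X => f.symm ⁻¹' P) '' 𝒪).subset ?_
      rintro _ ⟨_, ⟨U, hU, rfl⟩, rfl⟩
      refine ⟨_, ⟨U, hU, rfl⟩, ?_⟩
      ext V
      simp only [MulAction.orbit, Set.mem_image, Set.mem_range, exists_exists_eq_and]
      exact exists_congr fun π => by rw [← hpre π U]
    · rw [Set.sUnion_image, ← Set.preimage_sUnion, hcov', Set.preimage_univ]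
  · intro S y₁ y₂ hne
    have key : ∀ y, orbS S y = f.symm ⁻¹' orbS S (f.symm y) := fun y => by
      ext z
      refine exists_congr fun π => and_congr_right fun _ => ?_
      rw [← hge, f.symm.apply_eq_iff_eq]
    obtain ⟨U₁, U₂, h1, h2, hS1, hS2, hd, hx1, hx2⟩ := hT.hausdorff S (f.symm y₁) (f.symm y₂)
      fun h => hne (by rw [key, key, h])
    exact ⟨f.symm ⁻¹' U₁, f.symm ⁻¹' U₂, hfo _ h1, hfo _ h2, hpre.supports hS1, hpre.supports hS2,
      hd.preimage _, hx1, hx2⟩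
  · obtain ⟨𝓑, ⟨hB1, hB2, hB3, hB4⟩, hrep⟩ := hT.basis
    have hmem : ∀ R : Set Y, R ∈ (fun P : Set X => f.symm ⁻¹' P) '' 𝓑 ↔ f ⁻¹' R ∈ 𝓑 := by
      intro R
      constructor
      · rintro ⟨V, hV, rfl⟩
        simpa only [hfg] using hV
      · exact fun h => ⟨_, h, hgf R⟩
    refine ⟨(fun P : Set X => f.symm ⁻¹' P) '' 𝓑, ⟨?_, ?_, ?_, ?_⟩, ?_⟩
    · rintro _ ⟨R, hR, rfl⟩
      exact hfo _ (hB1 R hR)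
    · rintro π _ ⟨R, hR, rfl⟩
      exact ⟨π • R, hB2 π R hR, hpre π R⟩
    · intro U hU
      obtain ⟨𝒰, hfs, hsub, heq⟩ := hB3 _ (hfc U hU)
      refine ⟨(fun P : Set X => f.symm ⁻¹' P) '' 𝒰, (smul_image_set hpre).finSupp hfs, ?_, ?_⟩
      · rintro _ ⟨W, hW, rfl⟩
        obtain ⟨F, hF, hFB, rfl⟩ := hsub hW
        refine ⟨(fun P : Set X => f.symm ⁻¹' P) '' F, hF.image _, Set.image_mono hFB, ?_⟩
        rw [Set.sInter_image]
        exact Set.preimage_sInter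
      · rw [Set.sUnion_image, ← Set.preimage_sUnion, ← heq, hgf]
    · rintro W ⟨F, hF, hFB, rfl⟩
      obtain ⟨𝒰, hfs, hsub, heq⟩ := hB4 (⋂₀ ((fun P : Set Y => f ⁻¹' P) '' F))
        ⟨_, hF.image _, by
          rintro _ ⟨R, hR, rfl⟩
          exact (hmem R).1 (hFB hR), rfl⟩
      refine ⟨(fun P : Set X => f.symm ⁻¹' P) '' 𝒰, (smul_image_set hpre).finSupp hfs,
        Set.image_mono hsub, ?_⟩
      rw [Set.sUnion_image, ← Set.preimage_sUnion, ← heq, Set.sInter_image,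
        ← Set.preimage_sInter, hgf]
    · rintro _ ⟨R, hR, rfl⟩
      obtain ⟨Z, _, g, P, hn, hof, hg, hgc, hP, rfl⟩ := hrep R hR
      exact ⟨Z, _, g ∘ f.symm, P, hn, hof, fun π y => by
        rw [Function.comp_apply, hge, hg, Function.comp_apply], fun U hU => hfo _ (hgc U hU), hP, rfl⟩

end Topology

/-! ### Boolean isomorphisms and algebras of saturated sets -/

section Algebra

variable {A : Type v}

/-- An order isomorphism preserves all existing joins and meets, hence complements; only
equivariance has to be supplied. -/
theorem isOFCHom_of_orderIso {B B' : Type*} [BooleanAlgebra B] [MulAction (FinPerm A) B]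
    [BooleanAlgebra B'] [MulAction (FinPerm A) B'] (φ : B ≃o B') (hφ : Equivariant A φ) :
    IsOFCHom A φ where
  equivariant := hφ
  map_sup := map_sup φ
  map_inf := map_inf φ
  map_compl x := map_compl' φ x
  map_bot := map_bot φ
  map_top := map_top φ
  map_ofSup _ _ _ h := φ.isLUB_image'.2 h

theorem isOFCIso_of_orderIso {B B' : Type*} [BooleanAlgebra B] [MulAction (FinPerm A) B]
    [BooleanAlgebra B'] [MulAction (FinPerm A) B'] (φ : B ≃o B') (hφ : Equivariant A φ) :
    IsOFCIso A φ.toEquiv :=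
  ⟨isOFCHom_of_orderIso φ hφ, isOFCHom_of_orderIso φ.symm (Equivariant.symm (f := φ.toEquiv) hφ)⟩

theorem EqSubalg.coe_equivariant {B : Type u} [BooleanAlgebra B] [MulAction (FinPerm A) B]
    (C : EqSubalg A B) : Equivariant A (fun b : C.El => b.1) := fun _ _ => rfl

theorem EqSubalg.coe_injective {B : Type u} [BooleanAlgebra B] [MulAction (FinPerm A) B]
    (C : EqSubalg A B) : Function.Injective (fun b : C.El => b.1) := Subtype.val_injective

/-- The primeness condition covers the empty family, whose join is `⊥`. -/
theorem IsPrimeFilter.bot_notMem {k : ℕ} {B : Type u} [BooleanAlgebra B] [MulAction (FinPerm A) B]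
    {F : Set B} (hF : IsPrimeFilter A k F) : ⊥ ∉ F := by
  intro h
  obtain ⟨_, h, -⟩ := hF.prime ∅ ⊥ ⟨⟨∅, fun _ _ => Set.smul_set_empty⟩, by simp⟩
    (fun _ h => h.elim) isLUB_empty h
  exact h

/-- `L` is saturated for `f`, i.e. a union of fibres of `f`. -/
def Saturated {X Q : Type*} (f : X → Q) (L : Set X) : Prop :=
  ∀ x y, f x = f y → x ∈ L → y ∈ L

theorem Saturated.smul {X Q : Type*} [MulAction (FinPerm A) X] [MulAction (FinPerm A) Q]
    {f : X → Q} (hf : Equivariant A f) {L : Set X} (hL : Saturated f L) (π : FinPerm A) :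
    Saturated f (π • L) := by
  intro x y hxy hx
  rw [Set.mem_smul_set_iff_inv_smul_mem] at hx ⊢
  exact hL _ _ (by rw [hf, hf, hxy]) hx

/-- A saturated set is the preimage of its image, and the image under an equivariant map inherits a
finite support. -/
theorem saturated_iff {X Q : Type*} [MulAction (FinPerm A) X] [MulAction (FinPerm A) Q]
    {f : X → Q} (hf : Equivariant A f) {L : Set X} :
    FinSupp A L ∧ Saturated f L ↔ ∃ P : Set Q, FinSupp A P ∧ L = f ⁻¹' P := by
  constructor
  · rintro ⟨hL, hs⟩
    refine ⟨f '' L, (smul_image_set hf).finSupp hL, (Set.subset_preimage_image f L).antisymm ?_⟩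
    rintro y ⟨x, hx, hxy⟩
    exact hs x y hxy hx
  · rintro ⟨P, hP, rfl⟩
    refine ⟨(smul_preimage_set hf).finSupp hP, fun x y hxy hx => ?_⟩
    rw [Set.mem_preimage] at hx ⊢
    rwa [← hxy]

/-- The members of the set algebra `𝓢` are the finitely supported sets that are saturated for some
member of a directed family of equivariant maps into `k`-bounded orbit-finite nominal sets. -/
structure IsSaturationAlgebra {X : Type u} [MulAction (FinPerm A) X] (𝓢 : EqSubalg A (Set X))
    {I : Type*} {Q : I → Type*} [∀ i, MulAction (FinPerm A) (Q i)] (f : ∀ i, X → Q i) (k : ℕ) :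
    Prop where
  equivariant : ∀ i, Equivariant A (f i)
  nominal : ∀ i, IsNominal A (Q i)
  orbitFinite : ∀ i, OrbitFinite A (Q i)
  kBounded : ∀ i, IsKBounded A (Q i) k
  nonempty : Nonempty I
  directed : ∀ i j, ∃ l, ∀ x y, f l x = f l y → f i x = f i y ∧ f j x = f j y
  mem_iff : ∀ L : Set X, L ∈ 𝓢.toSub ↔ FinSupp A L ∧ ∃ i, Saturated (f i) L

namespace IsSaturationAlgebra

variable {X : Type u} [MulAction (FinPerm A) X] {𝓢 : EqSubalg A (Set X)}
    {I : Type*} {Q : I → Type*} [∀ i, MulAction (FinPerm A) (Q i)] {f : ∀ i, X → Q i} {k : ℕ}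

theorem finSupp (h : IsSaturationAlgebra 𝓢 f k) (L : 𝓢.El) : FinSupp A L :=
  (𝓢.coe_equivariant.finSupp_iff 𝓢.coe_injective).1 ((h.mem_iff L.1).1 L.2).1

/-- Saturation for an equivariant map is stable under permutations, so only finitely many orbit
representatives matter, and directedness gives them a common stage. -/
theorem exists_saturated (h : IsSaturationAlgebra 𝓢 f k) {Y : Set 𝓢.El} (hY : OrbitFiniteSet A Y) :
    ∃ i, ∀ L ∈ Y, Saturated (f i) (L : Set X) := by
  obtain ⟨R, -, hR, hrep⟩ := hY.exists_reps
  suffices ∃ i, ∀ L ∈ R, Saturated (f i) (L : Set X) by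
    obtain ⟨i, hi⟩ := this
    refine ⟨i, fun L hL => ?_⟩
    obtain ⟨r, hr, π, rfl⟩ := hrep L hL
    exact (hi r hr).smul (h.equivariant i) π
  clear hrep
  induction R, hR using Set.Finite.induction_on with
  | empty => exact ⟨h.nonempty.some, fun _ hL => hL.elim⟩
  | @insert L R _ _ ih =>
    obtain ⟨i, hi⟩ := ih
    obtain ⟨j, hj⟩ := ((h.mem_iff L.1).1 L.2).2
    obtain ⟨l, hl⟩ := h.directed i j
    refine ⟨l, ?_⟩
    rintro M (rfl | hM) x y hxy hx
    · exact hj x y (hl x y hxy).2 hx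
    · exact hi M hM x y (hl x y hxy).1 hx

theorem iUnion_mem (h : IsSaturationAlgebra 𝓢 f k) {Y : Set 𝓢.El} (hY : OrbitFiniteSet A Y) :
    ⋃₀ ((fun L : 𝓢.El => L.1) '' Y) ∈ 𝓢.toSub := by
  obtain ⟨i, hi⟩ := h.exists_saturated hY
  refine (h.mem_iff _).2 ⟨((smul_image_set 𝓢.coe_equivariant).finSupp hY.1).map Set.sUnion
    fun π => (smul_sUnion π _).symm, i, ?_⟩
  rintro x y hxy ⟨_, ⟨L, hL, rfl⟩, hx⟩
  exact ⟨L.1, ⟨L, hL, rfl⟩, hi L hL x y hxy hx⟩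

/-- Suprema of orbit-finite subsets are unions. -/
theorem isLUB_iff (h : IsSaturationAlgebra 𝓢 f k) {Y : Set 𝓢.El} (hY : OrbitFiniteSet A Y)
    (b : 𝓢.El) : IsLUB Y b ↔ b.1 = ⋃₀ ((fun L : 𝓢.El => L.1) '' Y) := by
  have hlub : IsLUB Y (⟨_, h.iUnion_mem hY⟩ : 𝓢.El) := by
    constructor
    · intro L hL
      exact fun x hx => ⟨L.1, ⟨L, hL, rfl⟩, hx⟩
    · intro M hM
      refine Set.sUnion_subset ?_
      rintro _ ⟨L, hL, rfl⟩
      exact hM hL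
  constructor
  · intro hb
    exact congrArg Subtype.val (hb.unique hlub)
  · intro hb
    rwa [show b = ⟨_, h.iUnion_mem hY⟩ from Subtype.ext hb]

variable (𝓢) in
/-- The members of `𝓢` that are saturated for a given map. -/
def stage {Z : Type*} [MulAction (FinPerm A) Z] (g : X → Z) (hg : Equivariant A g) :
    EqSubalg A 𝓢.El where
  toSub :=
    { carrier := {L | Saturated g L.1}
      supClosed' := fun _ hL _ hM x y hxy hx => hx.imp (hL x y hxy) (hM x y hxy)
      infClosed' := fun _ hL _ hM x y hxy hx => hx.imp (hL x y hxy) (hM x y hxy)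
      compl_mem' := fun {_} hL x y hxy hx hy => hx (hL y x hxy.symm hy)
      bot_mem' := fun _ _ _ hx => hx }
  smul_mem π L hL := Saturated.smul (L := L.1) hg hL π

theorem fibre_mem (h : IsSaturationAlgebra 𝓢 f k) (i : I) (q : Q i) :
    f i ⁻¹' {q} ∈ 𝓢.toSub := by
  have := (saturated_iff (h.equivariant i)).2 ⟨{q}, (h.nominal i q).map (fun q => ({q} : Set (Q i)))
    fun π => Set.smul_set_singleton.symm, rfl⟩
  exact (h.mem_iff _).2 ⟨this.1, i, this.2⟩

/-- The fibre of `f i` over `q`. -/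
def fibre (h : IsSaturationAlgebra 𝓢 f k) (i : I) (q : Q i) : 𝓢.El := ⟨_, h.fibre_mem i q⟩

theorem fibre_equivariant (h : IsSaturationAlgebra 𝓢 f k) (i : I) : Equivariant A (h.fibre i) := by
  intro π q
  refine Subtype.ext ?_
  change f i ⁻¹' {π • q} = π • (f i ⁻¹' {q})
  rw [smul_preimage (h.equivariant i), Set.smul_set_singleton]

theorem orbitFiniteSet_range {Z W : Type*} [MulAction (FinPerm A) Z] [MulAction (FinPerm A) W]
    {g : Z → W} (hg : Equivariant A g) (hof : OrbitFinite A Z) :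
    OrbitFiniteSet A (Set.range g) := by
  have : Finite (MulAction.orbitRel.Quotient (FinPerm A) Z) := hof
  refine OrbitFiniteSet.of_reps ⟨∅, fun π _ => ?_⟩ (Set.finite_range fun
    p : MulAction.orbitRel.Quotient (FinPerm A) Z => g (Quotient.out p)) ?_
  · ext w
    rw [Set.mem_smul_set_iff_inv_smul_mem]
    constructor
    · rintro ⟨z, hz⟩
      exact ⟨π • z, by rw [hg, hz, smul_inv_smul]⟩
    · rintro ⟨z, rfl⟩
      exact ⟨π⁻¹ • z, hg _ _⟩
  · rintro _ ⟨z, rfl⟩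
    obtain ⟨π, hπ⟩ := MulAction.orbitRel_apply.1
      (Quotient.mk_out (s := MulAction.orbitRel (FinPerm A) Z) z)
    exact ⟨π, Quotient.mk'' z, by rw [← hg]; exact congrArg g hπ.symm⟩

theorem orbitFiniteSet_range_fibre (h : IsSaturationAlgebra 𝓢 f k) (i : I) :
    OrbitFiniteSet A (Set.range (h.fibre i)) :=
  orbitFiniteSet_range (h.fibre_equivariant i) (h.orbitFinite i)

theorem kBoundedSet_range_fibre (h : IsSaturationAlgebra 𝓢 f k) (i : I) :
    KBoundedSet A k (Set.range (h.fibre i)) := by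
  rintro _ ⟨q, rfl⟩
  exact (Set.encard_le_encard ((h.fibre_equivariant i).supp_subset q)).trans
    (h.kBounded i q trivial)

/-- A member of the stage contains the whole fibre through each of its points, so fibres are minimal
and every nonempty member contains one. Only values attained by `f i` occur: other fibres are empty.
-/
theorem isAtom_stage_iff (h : IsSaturationAlgebra 𝓢 f k) (i : I)
    (a : (stage 𝓢 (f i) (h.equivariant i)).El) :
    IsAtom a ↔ ∃ x : X, a.1 = h.fibre i (f i x) := by
  have hfib : ∀ x : X, h.fibre i (f i x) ∈ (stage 𝓢 (f i) (h.equivariant i)).toSub :=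
    fun x y z hyz hy => hyz.symm.trans hy
  have hne : ∀ b : (stage 𝓢 (f i) (h.equivariant i)).El, b ≠ ⊥ → ∃ x, x ∈ b.1.1 := by
    intro b hb
    by_contra hx
    push Not at hx
    exact hb (Subtype.ext (Subtype.ext (Set.eq_empty_of_forall_notMem hx)))
  constructor
  · intro ha
    obtain ⟨x, hx⟩ := hne a ha.1
    refine ⟨x, ?_⟩
    have hle : (⟨_, hfib x⟩ : (stage 𝓢 (f i) (h.equivariant i)).El) ≤ a :=
      fun y hy => a.2 x y (Eq.symm hy) hx
    rcases ha.le_iff.1 hle with h0 | h1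
    · have h2 : x ∈ (h.fibre i (f i x)).1 := rfl
      have h3 : (h.fibre i (f i x)).1 = (∅ : Set X) :=
        congrArg (fun b : (stage 𝓢 (f i) (h.equivariant i)).El => b.1.1) h0
      rw [h3] at h2
      exact h2.elim
    · exact (congrArg Subtype.val h1).symm
  · rintro ⟨x, hx⟩
    refine ⟨?_, fun b hb => ?_⟩
    · rintro rfl
      have h2 : x ∈ (h.fibre i (f i x)).1 := rfl
      rw [← hx] at h2
      exact h2.elim
    · by_contra hb0
      obtain ⟨y, hy⟩ := hne b hb0
      refine hb.not_ge ?_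
      have h1 : y ∈ (h.fibre i (f i x)).1 := hx ▸ hb.le hy
      intro z hz
      have h2 : z ∈ (h.fibre i (f i x)).1 := hx ▸ hz
      exact b.2 y z (Eq.trans h1 (Eq.symm h2)) hy

theorem isKAtomic_stage (h : IsSaturationAlgebra 𝓢 f k) (i : I) :
    IsKAtomic A (stage 𝓢 (f i) (h.equivariant i)).El k := by
  have hfib : ∀ q, h.fibre i q ∈ (stage 𝓢 (f i) (h.equivariant i)).toSub :=
    fun q y z hyz hy => hyz.symm.trans hy
  have hinj := (stage 𝓢 (f i) (h.equivariant i)).coe_injective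
  have heq := (stage 𝓢 (f i) (h.equivariant i)).coe_equivariant
  refine ⟨fun b => ⟨fun a ha => ha.2, fun c hc x hx => ?_⟩, ?_, ?_⟩
  · refine hc (a := ⟨_, hfib (f i x)⟩) ⟨(h.isAtom_stage_iff i _).2 ⟨x, rfl⟩, ?_⟩
      (show x ∈ (h.fibre i (f i x)).1 from rfl)
    exact fun y hy => b.2 x y (Eq.symm hy) hx
  -- Indexing by all of `Q i` may add the empty fibre, which does no harm: the range only has to
  -- contain the atoms.
  · let fib : Q i → (stage 𝓢 (f i) (h.equivariant i)).El := fun q => ⟨h.fibre i q, hfib q⟩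
    have hor := orbitFiniteSet_range (g := fib) (fun π q => hinj (h.fibre_equivariant i π q)) (h.orbitFinite i)
    refine ⟨⟨∅, fun π _ => ?_⟩, hor.2.subset (Set.image_mono ?_)⟩
    · have hsub : ∀ (σ : FinPerm A) (a : (stage 𝓢 (f i) (h.equivariant i)).El),
          IsAtom a → IsAtom (σ • a) := by
        intro σ a ha
        obtain ⟨x, hx⟩ := (h.isAtom_stage_iff i a).1 ha
        refine (h.isAtom_stage_iff i _).2 ⟨σ • x, ?_⟩
        rw [h.equivariant i, h.fibre_equivariant, ← hx]
        rfl
      ext a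
      rw [Set.mem_smul_set_iff_inv_smul_mem]
      exact ⟨fun ha => by simpa using hsub π _ ha, fun ha => hsub π⁻¹ _ ha⟩
    · intro a ha
      obtain ⟨x, hx⟩ := (h.isAtom_stage_iff i a).1 ha
      exact ⟨f i x, Subtype.ext hx.symm⟩
  · intro a ha
    obtain ⟨x, hx⟩ := (h.isAtom_stage_iff i a).1 ha
    rw [← heq.supp_eq hinj, hx]
    exact h.kBoundedSet_range_fibre i _ ⟨_, rfl⟩

theorem isLocallyKAtomicOFCBA (h : IsSaturationAlgebra 𝓢 f k) :
    IsLocallyKAtomicOFCBA A 𝓢.El k where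
  nominal := h.finSupp
  equivariant := inferInstance
  complete Y hY := ⟨⟨_, h.iUnion_mem hY⟩, (h.isLUB_iff hY _).2 rfl⟩
  locallyAtomic b := by
    obtain ⟨i, hi⟩ := ((h.mem_iff b.1).1 b.2).2
    refine ⟨stage 𝓢 (f i) (h.equivariant i), fun Y hY hof c hc => ?_, h.isKAtomic_stage i, hi⟩
    have hc' := (h.isLUB_iff hof c).1 hc
    intro x y hxy hx
    rw [hc'] at hx ⊢
    obtain ⟨_, ⟨L, hL, rfl⟩, hx⟩ := hx
    exact ⟨L.1, ⟨L, hL, rfl⟩, hY L hL x y hxy hx⟩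

end IsSaturationAlgebra

end Algebra

/-! ### The codirected system of bounded quotients -/

section Quotients

variable {A : Type v} {Al : Type u} [MulAction (FinPerm A) Al] {s : FreeMonoid Al → Finset A}
  {k : ℕ}

/-- The equivariant kernel congruence of an equivariant morphism. -/
def EqCon.ker {M : Type*} [Monoid M] [MulDistribMulAction (FinPerm A) M] (h : FreeMonoid Al →* M)
    (hh : Equivariant A h) : EqCon A Al where
  con := Con.ker h
  smul π u v huv := by
    rw [Con.ker_rel] at huv ⊢
    rw [hh, hh, huv]

theorem EqCon.proj_equivariant (c : EqCon A Al) : Equivariant A c.proj := c.proj_smul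

theorem EqCon.proj_eq_iff (c : EqCon A Al) {u w : FreeMonoid Al} :
    c.proj u = c.proj w ↔ c.con u w := Con.eq c.con

theorem EqCon.conn_proj (c d : EqCon A Al) (h : c.con ≤ d.con) (w : FreeMonoid Al) :
    c.conn d h (c.proj w) = d.proj w := rfl

/-- The embedding of the quotient by the kernel. -/
def EqCon.kerLift {M : Type*} [Monoid M] [MulDistribMulAction (FinPerm A) M]
    (h : FreeMonoid Al →* M) (hh : Equivariant A h) : (EqCon.ker h hh).Q → M :=
  Con.kerLift h

theorem EqCon.kerLift_injective {M : Type*} [Monoid M] [MulDistribMulAction (FinPerm A) M]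
    (h : FreeMonoid Al →* M) (hh : Equivariant A h) : Function.Injective (EqCon.kerLift h hh) :=
  Con.kerLift_injective h

theorem EqCon.kerLift_proj {M : Type*} [Monoid M] [MulDistribMulAction (FinPerm A) M]
    (h : FreeMonoid Al →* M) (hh : Equivariant A h) (w : FreeMonoid Al) :
    EqCon.kerLift h hh ((EqCon.ker h hh).proj w) = h w := rfl

theorem EqCon.kerLift_equivariant {M : Type*} [Monoid M] [MulDistribMulAction (FinPerm A) M]
    (h : FreeMonoid Al →* M) (hh : Equivariant A h) : Equivariant A (EqCon.kerLift h hh) := by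
  intro π x
  obtain ⟨w, rfl⟩ := (EqCon.ker h hh).proj_surjective x
  exact hh π w

/-- The `s`-bounded quotient given by the image of an `s`-bounded morphism. -/
def SQuot.ofHom (hs : ∀ w, (s w).card ≤ k) {M : Type*} [Monoid M]
    [MulDistribMulAction (FinPerm A) M] (h : FreeMonoid Al →* M) (hh : Equivariant A h)
    (hM : IsNominal A M) (hof : OrbitFinite A M) (hb : SBounded s h) : SQuot s k where
  toEqCon := EqCon.ker h hh
  nominal x := ((EqCon.kerLift_equivariant h hh).finSupp_iff (EqCon.kerLift_injective h hh)).1 (hM _)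
  orbitFinite := (EqCon.kerLift_equivariant h hh).orbitFinite (EqCon.kerLift_injective h hh) hof
  kBounded x _ := by
    obtain ⟨w, rfl⟩ := (EqCon.ker h hh).proj_surjective x
    rw [← (EqCon.kerLift_equivariant h hh).supp_eq (EqCon.kerLift_injective h hh),
      EqCon.kerLift_proj]
    refine (Set.encard_le_encard (hb w)).trans ?_
    rw [Set.encard_coe_eq_coe_finsetCard]
    exact_mod_cast hs w
  sBounded w := by
    rw [← (EqCon.kerLift_equivariant h hh).supp_eq (EqCon.kerLift_injective h hh),
      EqCon.kerLift_proj]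
    exact hb w

/-- Smaller means finer: `c ≤ d` says that the projection to `d` factors through the one to `c`. -/
instance : Preorder (SQuot s k) := Preorder.lift fun c => c.con

/-- The common refinement is the image of the words in the product monoid. It stays `k`-bounded
because `s w` supports both components of the image of `w`; for the full product one would only get
`2 * k`. -/
theorem SQuot.exists_le_le [Infinite A] (hs : ∀ w, (s w).card ≤ k) (c d : SQuot s k) :
    ∃ e : SQuot s k, e ≤ c ∧ e ≤ d := by
  refine ⟨SQuot.ofHom hs (c.proj.prod d.proj)
    (fun π w => Prod.ext (c.proj_smul π w) (d.proj_smul π w))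
    (fun x => (c.nominal x.1).map₂ (d.nominal x.2) Prod.mk fun π => rfl)
    (c.orbitFinite.prod c.nominal d.nominal d.orbitFinite) (fun w => ?_), ?_, ?_⟩
  · have h1 := (supp_subset_iff (c.nominal (c.proj w)) (s w)).1 (c.sBounded w)
    have h2 := (supp_subset_iff (d.nominal (d.proj w)) (s w)).1 (d.sBounded w)
    exact Set.sInter_subset_of_mem ⟨(s w).finite_toSet, fun π hπ =>
      Prod.ext (h1 π hπ) (h2 π hπ)⟩
  · intro u w huw
    exact c.proj_eq_iff.1 (congrArg Prod.fst ((Con.ker_rel _).1 huw))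
  · intro u w huw
    exact d.proj_eq_iff.1 (congrArg Prod.snd ((Con.ker_rel _).1 huw))

/-- Replacing the monoid by the image of the morphism makes it `k`-bounded, so recognition can be
tested on the diagram that defines the limit. -/
theorem sRecognizable_iff (hs : ∀ w, (s w).card ≤ k) (L : Set (FreeMonoid Al)) :
    SRecognizable s L ↔ ∃ (c : SQuot s k) (P : Set c.Q), FinSupp A P ∧ L = c.proj ⁻¹' P := by
  constructor
  · rintro ⟨M, _, _, h, P, hM, hof, hh, hb, hP, rfl⟩
    exact ⟨SQuot.ofHom hs h hh hM hof hb, EqCon.kerLift h hh ⁻¹' P,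
      (smul_preimage_set (EqCon.kerLift_equivariant h hh)).finSupp hP, rfl⟩
  · rintro ⟨c, P, hP, rfl⟩
    exact ⟨c.Q, _, _, c.proj, P, c.nominal, c.orbitFinite, c.proj_smul, c.sBounded, hP, rfl⟩

theorem SQuot.nonempty [Infinite A] (hs : ∀ w, (s w).card ≤ k) : Nonempty (SQuot s k) := by
  -- Any recognizable language comes with a quotient; the empty language is one.
  obtain ⟨c, -⟩ := (sRecognizable_iff hs _).1 (recAlg s).toSub.bot_mem
  exact ⟨c⟩

theorem SQuot.exists_le_finite [Infinite A] (hs : ∀ w, (s w).card ≤ k) {C : Set (SQuot s k)}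
    (hC : C.Finite) : ∃ e : SQuot s k, ∀ c ∈ C, e ≤ c := by
  induction C, hC using Set.Finite.induction_on with
  | empty => exact ⟨(SQuot.nonempty hs).some, fun _ h => h.elim⟩
  | @insert c C _ _ ih =>
    obtain ⟨d, hd⟩ := ih
    obtain ⟨e, hec, hed⟩ := SQuot.exists_le_le hs c d
    refine ⟨e, ?_⟩
    rintro c' (rfl | hc')
    exacts [hec, hed.trans (hd c' hc')]

/-- The language algebra is the algebra of finitely supported languages saturated for some
`s`-bounded quotient. -/
theorem isSaturationAlgebra_recAlg [Infinite A] (hs : ∀ w, (s w).card ≤ k) :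
    IsSaturationAlgebra (recAlg s) (fun (c : SQuot s k) w => c.proj w) k where
  equivariant c := c.proj_smul
  nominal c := c.nominal
  orbitFinite c := c.orbitFinite
  kBounded c := c.kBounded
  nonempty := SQuot.nonempty hs
  directed c d := by
    obtain ⟨e, hec, hed⟩ := SQuot.exists_le_le hs c d
    exact ⟨e, fun u w h => ⟨c.proj_eq_iff.2 (hec (e.proj_eq_iff.1 h)),
      d.proj_eq_iff.2 (hed (e.proj_eq_iff.1 h))⟩⟩
  mem_iff L := by
    refine (sRecognizable_iff hs L).trans ?_
    rw [← exists_and_left]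
    exact exists_congr fun c => (saturated_iff c.proj_equivariant).symm

end Quotients

/-! ### The limit space: supports, Stone properties, clopen sets -/

section ProWords

variable {A : Type v} {Al : Type u} [MulAction (FinPerm A) Al] {s : FreeMonoid Al → Finset A}
  {k : ℕ}

/-- The projections from the limit. -/
def ProWords.val (c : SQuot s k) (x : ProWords s k) : c.Q := x.1 c

theorem ProWords.val_equivariant (c : SQuot s k) : Equivariant A (ProWords.val c) :=
  fun _ _ => rfl

theorem ProWords.ext {x y : ProWords s k} (h : ∀ c, x.val c = y.val c) : x = y :=
  Subtype.ext (funext h)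

theorem ProWords.conn_val {c d : SQuot s k} (h : c ≤ d) (x : ProWords s k) :
    c.conn d.toEqCon h (x.val c) = x.val d := x.2 c d h

theorem ProWords.val_eq_of_le {c d : SQuot s k} (h : c ≤ d) {x y : ProWords s k}
    (hxy : x.val c = y.val c) : x.val d = y.val d := by
  rw [← ProWords.conn_val h, ← ProWords.conn_val h, hxy]

theorem eta_equivariant : Equivariant A (eta s k) := fun _ _ => rfl

/-- Words are dense: each projection of a point is attained by a word. -/
theorem ProWords.exists_eta_val_eq (c : SQuot s k) (x : ProWords s k) :
    ∃ w, (eta s k w).val c = x.val c := c.proj_surjective (x.val c)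

theorem proWordsTop_isOpen_preimage (c : SQuot s k) {U : Set c.Q} (hU : FinSupp A U) :
    (proWordsTop s k).IsOpen (ProWords.val c ⁻¹' U) :=
  NomTop.generate_isOpen_of_mem _ ⟨c, U, hU, rfl⟩
    ((smul_preimage_set (ProWords.val_equivariant c)).finSupp hU)

theorem finSupp_singleton {X : Type*} [MulAction (FinPerm A) X] {x : X} (hx : FinSupp A x) :
    FinSupp A ({x} : Set X) :=
  hx.map (fun x => ({x} : Set X)) fun _ => Set.smul_set_singleton.symm

variable [Infinite A]

/-- Supports of coordinates grow under refinement and have at most `k` names, so a coordinate with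
the largest support has the support of the whole point. -/
theorem ProWords.exists_supp_eq (hs : ∀ w, (s w).card ≤ k) (x : ProWords s k) :
    ∃ c : SQuot s k, FinSupp A x ∧ ∀ d ≤ c, supp A (x.val d) = supp A x := by
  have hfin : ∀ c, (supp A (x.val c)).Finite := fun c => (supports_supp (c.nominal _)).1
  have hle : ∀ c, (supp A (x.val c)).ncard ≤ k := fun c => by
    have := c.kBounded (x.val c) trivial
    rw [← (hfin c).cast_ncard_eq] at this
    exact_mod_cast this
  obtain ⟨n, ⟨c, rfl⟩, hn⟩ : ∃ n ∈ Set.range fun c : SQuot s k => (supp A (x.val c)).ncard,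
      ∀ m ∈ Set.range fun c : SQuot s k => (supp A (x.val c)).ncard, m ≤ n := by
    have := SQuot.nonempty hs
    have hb : BddAbove (Set.range fun c : SQuot s k => (supp A (x.val c)).ncard) :=
      ⟨k, by rintro _ ⟨c, rfl⟩; exact hle c⟩
    exact ⟨_, Nat.sSup_mem (Set.range_nonempty _) hb, fun m hm => le_csSup hb hm⟩
  have hmono : ∀ d e : SQuot s k, d ≤ e → supp A (x.val e) ⊆ supp A (x.val d) := by
    intro d e hde
    rw [← ProWords.conn_val hde]
    exact Equivariant.supp_subset (d.conn_smul e.toEqCon hde) _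
  have hmax : ∀ d ≤ c, supp A (x.val d) = supp A (x.val c) := fun d hd =>
    (Set.eq_of_subset_of_ncard_le (hmono d c hd) (hn _ ⟨d, rfl⟩) (hfin d)).symm
  -- Codirectedness: compare `d` with a common refinement of `c` and `d`, where the support is still
  -- that of coordinate `c`.
  have hsub : ∀ d, supp A (x.val d) ⊆ supp A (x.val c) := fun d => by
    obtain ⟨e, hec, hed⟩ := SQuot.exists_le_le hs c d
    rw [← hmax e hec]
    exact hmono e d hed
  have hsupp : MulAction.Supports (FinPerm A) (supp A (x.val c)) x := fun π hπ =>
    ProWords.ext fun d => ((supports_supp (d.nominal (x.val d))).2.mono (hsub d)) π hπ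
  have hx : FinSupp A x := ⟨(hfin c).toFinset, by rwa [(hfin c).coe_toFinset]⟩
  refine ⟨c, hx, fun d hd => ?_⟩
  rw [hmax d hd]
  exact ((ProWords.val_equivariant c).supp_subset x).antisymm
    (Set.sInter_subset_of_mem ⟨hfin c, hsupp⟩)

theorem ProWords.isNominal (hs : ∀ w, (s w).card ≤ k) : IsNominal A (ProWords s k) := fun x => by
  obtain ⟨c, h, -⟩ := x.exists_supp_eq hs
  exact h

theorem ProWords.isKBounded (hs : ∀ w, (s w).card ≤ k) : IsKBounded A (ProWords s k) k := by
  intro x _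
  obtain ⟨c, -, h⟩ := x.exists_supp_eq hs
  rw [← h c le_rfl]
  exact c.kBounded _ trivial

/-- A finite intersection of subbasic sets constrains finitely many coordinates, and a common
refinement of them determines all. -/
theorem proWordsTop_isOpen_iff (hs : ∀ w, (s w).card ≤ k) (U : Set (ProWords s k)) :
    (proWordsTop s k).IsOpen U ↔
      FinSupp A U ∧ ∀ x ∈ U, ∃ c : SQuot s k, ∀ y : ProWords s k, y.val c = x.val c → y ∈ U := by
  constructor
  · intro hU
    refine ⟨(proWordsTop s k).finSupp U hU, fun x hx => ?_⟩
    obtain ⟨𝒰, -, hsub, rfl⟩ := hU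
    obtain ⟨W, hW, hxW⟩ := hx
    obtain ⟨F, hF, hFB, rfl⟩ := hsub hW
    have hex : ∀ V : F, ∃ c : SQuot s k, ∀ y : ProWords s k, y.val c = x.val c → y ∈ V.1 := by
      rintro ⟨V, hV⟩
      obtain ⟨c, P, -, rfl⟩ := hFB hV
      refine ⟨c, fun y hy => ?_⟩
      have hxP : x.val c ∈ P := hxW _ hV
      rw [← hy] at hxP
      exact hxP
    choose c hc using hex
    have : Finite F := hF
    obtain ⟨e, he⟩ := SQuot.exists_le_finite hs (Set.finite_range c)
    exact ⟨e, fun y hy => ⟨_, hW, fun V hV =>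
      hc ⟨V, hV⟩ y (ProWords.val_eq_of_le (he _ ⟨_, rfl⟩) hy)⟩⟩
  · rintro ⟨hU, h⟩
    refine (isFSUnion_iff (fun π _ => smul_mem_finiteInters (by
      rintro π _ ⟨c, U, hU, rfl⟩
      exact ⟨c, π • U, hU.smul π, smul_preimage (ProWords.val_equivariant c) π U⟩) π) U).2
      ⟨hU, fun x hx => ?_⟩
    obtain ⟨c, hc⟩ := h x hx
    refine ⟨ProWords.val c ⁻¹' {x.val c}, ⟨{ProWords.val c ⁻¹' {x.val c}}, Set.finite_singleton _,
      ?_, by simp⟩, rfl, hc⟩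
    rintro _ rfl
    exact ⟨c, {x.val c}, finSupp_singleton (c.nominal _), rfl⟩

open scoped CategoryTheory in
/-- Every finitely supported open cover is refined by the fibres of one of the projections. -/
theorem proWordsTop_exists_fibre_subset (hs : ∀ w, (s w).card ≤ k) {𝒞 : Set (Set (ProWords s k))}
    (hfs : FinSupp A 𝒞) (hop : ∀ U ∈ 𝒞, (proWordsTop s k).IsOpen U) (hcov : ⋃₀ 𝒞 = Set.univ) :
    ∃ c : SQuot s k, ∀ q : c.Q, ∃ U ∈ 𝒞, ProWords.val c ⁻¹' {q} ⊆ U := by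
  classical
  by_contra hno
  push Not at hno
  obtain ⟨S, hS⟩ := hfs
  obtain ⟨D, hD, hSD⟩ := exists_fresh_finset S k
  -- The bad elements supported by `S ∪ D`: without this restriction the set need not be finite;
  -- with it the set is still nonempty, since badness is invariant under permutations fixing `S`.
  let N : ∀ c : SQuot s k, Set c.Q := fun c =>
    {q | MulAction.Supports (FinPerm A) ((S ∪ D : Finset A) : Set A) q ∧
      ∀ U ∈ 𝒞, ¬ ProWords.val c ⁻¹' {q} ⊆ U}
  have hNfin : ∀ c, (N c).Finite := fun c =>
    (c.orbitFinite.finite_supports c.nominal (S ∪ D)).subset fun q hq => hq.1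
  have hNne : ∀ c, (N c).Nonempty := by
    intro c
    obtain ⟨q, hq⟩ := hno c
    obtain ⟨π, hπS, hπ⟩ := exists_smul_supports (c.nominal q) (c.kBounded q trivial) hD hSD
    refine ⟨π • q, by rwa [Finset.coe_union], fun U hU hsub => hq (π⁻¹ • U) ?_ ?_⟩
    · have h𝒞 := hS π fun a ha => hπS a ha
      rw [← h𝒞] at hU
      exact Set.mem_smul_set_iff_inv_smul_mem.1 hU
    · rw [← Set.smul_set_subset_smul_set_iff (a := π), smul_inv_smul,
        smul_preimage (ProWords.val_equivariant c), Set.smul_set_singleton]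
      exact hsub
  have hNmap : ∀ (c d : SQuot s k) (h : c ≤ d), ∀ q ∈ N c, c.conn d.toEqCon h q ∈ N d := by
    rintro c d h q ⟨hq, hq'⟩
    refine ⟨Equivariant.supports (c.conn_smul d.toEqCon h) hq, fun U hU hsub => hq' U hU ?_⟩
    rintro x rfl
    exact hsub (ProWords.conn_val h x).symm
  let F : SQuot s k ⥤ Type u :=
    { obj := fun c => N c
      map := fun {c d} f => ↾ fun q => ⟨c.conn d.toEqCon f.le q.1, hNmap c d f.le q.1 q.2⟩
      map_id := fun c => by
        ext q
        obtain ⟨w, hw⟩ := c.proj_surjective q.1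
        change c.conn c.toEqCon _ q.1 = q.1
        rw [← hw, EqCon.conn_proj]
      map_comp := fun {c d e} f g => by
        ext q
        obtain ⟨w, hw⟩ := c.proj_surjective q.1
        change c.conn e.toEqCon _ q.1 = d.conn e.toEqCon _ (c.conn d.toEqCon _ q.1)
        rw [← hw, EqCon.conn_proj, EqCon.conn_proj, EqCon.conn_proj] }
  have : IsCodirectedOrder (SQuot s k) := ⟨fun c d => SQuot.exists_le_le hs c d⟩
  have : ∀ c, Finite (F.obj c) := fun c => hNfin c
  have : ∀ c, Nonempty (F.obj c) := fun c => (hNne c).to_subtype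
  -- A codirected system of finite nonempty sets has a compatible family: here a point, all of whose
  -- fibres are bad. Yet some member of the cover is an open neighbourhood of it and contains one of
  -- these fibres.
  obtain ⟨y, hy⟩ := nonempty_sections_of_finite_cofiltered_system F
  let x : ProWords s k := ⟨fun c => (y c).1, fun c d h =>
    congrArg Subtype.val (hy (CategoryTheory.homOfLE h))⟩
  obtain ⟨U, hU, hxU⟩ : x ∈ ⋃₀ 𝒞 := hcov ▸ trivial
  obtain ⟨c, hc⟩ := ((proWordsTop_isOpen_iff hs U).1 (hop U hU)).2 x hxU
  exact (y c).2.2 U hU fun z hz => hc z hz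

/-- Take a cover member for each of the finitely many `q` supported by `S ∪ D`, and close this
choice under permutations fixing `S`. Since `S` supports the cover, this stays inside it, and every
point can be moved over one of those `q`. -/
theorem proWordsTop_isCompact (hs : ∀ w, (s w).card ≤ k) : (proWordsTop s k).IsCompact := by
  classical
  intro 𝒞 hfs hop hcov
  obtain ⟨c, hc⟩ := proWordsTop_exists_fibre_subset hs hfs hop hcov
  choose U hUmem hU using hc
  obtain ⟨S, hS⟩ := hfs
  obtain ⟨D, hD, hSD⟩ := exists_fresh_finset S k
  have hR := (c.orbitFinite.finite_supports c.nominal (S ∪ D)).image U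
  set R := U '' {q | MulAction.Supports (FinPerm A) ((S ∪ D : Finset A) : Set A) q} with hRdef
  refine ⟨⋃ V ∈ R, orbS S V, ?_, OrbitFiniteSet.of_reps ⟨S, fun π hπ => ?_⟩ hR ?_, ?_⟩
  · simp only [Set.iUnion_subset_iff]
    rintro _ ⟨q, -, rfl⟩ _ ⟨π, hπ, rfl⟩
    rw [← hS π fun a ha => hπ a ha]
    exact Set.smul_mem_smul_set (hUmem q)
  · simp only [Set.smul_set_iUnion, supports_orbS S _ π hπ]
  · intro V hV
    simp only [Set.mem_iUnion] at hV
    obtain ⟨W, hW, π, hπ, rfl⟩ := hV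
    exact ⟨π⁻¹, by rwa [inv_smul_smul]⟩
  · refine Set.eq_univ_of_forall fun x => ?_
    obtain ⟨π, hπS, hπ⟩ := exists_smul_supports (c.nominal (x.val c)) (c.kBounded _ trivial) hD hSD
    refine ⟨π⁻¹ • U (π • x.val c), Set.mem_biUnion (x := U (π • x.val c))
      ⟨_, by rw [Set.mem_ofPred_eq, Finset.coe_union]; exact hπ, rfl⟩
      ⟨π⁻¹, supports_coe_inv hπS, rfl⟩, ?_⟩
    rw [Set.mem_inv_smul_set_iff]
    exact hU _ (ProWords.val_equivariant c π x)

/-- It suffices to separate the `S`-orbits at one coordinate, as preimages of `S`-orbits are open.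
If no coordinate did, then far enough down a translate of `x₁` agreeing there with `x₂` would have
the support of `x₂`; only finitely many translates do, and one coordinate tells all of them from
`x₂`. -/
theorem proWordsTop_isHausdorff (hs : ∀ w, (s w).card ≤ k) : (proWordsTop s k).IsHausdorff := by
  intro S x₁ x₂ hne
  suffices ∃ c : SQuot s k, x₂.val c ∉ orbS S (x₁.val c) by
    obtain ⟨c, hc⟩ := this
    refine ⟨ProWords.val c ⁻¹' orbS S (x₁.val c), ProWords.val c ⁻¹' orbS S (x₂.val c),
      proWordsTop_isOpen_preimage c ⟨S, supports_orbS S _⟩,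
      proWordsTop_isOpen_preimage c ⟨S, supports_orbS S _⟩,
      (smul_preimage_set (ProWords.val_equivariant c)).supports (supports_orbS S _),
      (smul_preimage_set (ProWords.val_equivariant c)).supports (supports_orbS S _),
      Disjoint.preimage _ (Set.disjoint_left.2 fun q h1 h2 => hc ?_),
      mem_orbS_self S _, mem_orbS_self S _⟩
    rw [← orbS_eq_of_mem h1, orbS_eq_of_mem h2]
    exact mem_orbS_self S _
  by_contra hall
  push Not at hall
  obtain ⟨c₁, hx₁, hc₁⟩ := x₁.exists_supp_eq hs
  obtain ⟨c₂, hx₂, hc₂⟩ := x₂.exists_supp_eq hs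
  obtain ⟨e, he₁, he₂⟩ := SQuot.exists_le_le hs c₁ c₂
  have hF := (supports_supp hx₂).1
  let Y := {y | y ∈ orbS S x₁ ∧ MulAction.Supports (FinPerm A) (supp A x₂) y}
  have hY : Y.Finite := by
    refine (finite_orbit_inter_supports hF.toFinset hx₁).subset ?_
    rintro _ ⟨⟨π, -, rfl⟩, h⟩
    exact ⟨⟨π, rfl⟩, by rwa [hF.coe_toFinset]⟩
  have hsep : ∀ y : Y, ∃ c : SQuot s k, y.1.val c ≠ x₂.val c := by
    rintro ⟨y, hy, -⟩
    by_contra h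
    push Not at h
    obtain rfl : y = x₂ := ProWords.ext h
    exact hne (orbS_eq_of_mem hy).symm
  choose c hc using hsep
  have : Finite Y := hY
  obtain ⟨d, hd⟩ := SQuot.exists_le_finite hs ((Set.finite_range c).insert e)
  obtain ⟨π, hπ, hπx⟩ := hall d
  have hde : d ≤ e := hd e (Set.mem_insert _ _)
  -- Below `e` both points have the supports of their coordinates, so agreement at `d` equates the
  -- supports of `π • x₁` and `x₂`.
  have hmem : π • x₁ ∈ Y := by
    refine ⟨⟨π, hπ, rfl⟩, ?_⟩
    rw [← hc₂ d (hde.trans he₂), ← hπx, supp_smul, supports_smul_iff, hc₁ d (hde.trans he₁)]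
    exact (supports_supp hx₁).2
  exact hc ⟨_, hmem⟩ (ProWords.val_eq_of_le (hd _ (Set.mem_insert_of_mem _ ⟨_, rfl⟩)) hπx)

/-- The generating family serves as basis: by pulling back to a common refinement it is closed under
finite intersections. -/
theorem proWordsTop_exists_basis (hs : ∀ w, (s w).card ≤ k) :
    ∃ 𝓑 : Set (Set (ProWords s k)), (proWordsTop s k).IsBasis 𝓑 ∧
      ∀ R ∈ 𝓑, (proWordsTop s k).IsRepresentable R := by
  refine ⟨{W | ∃ (c : SQuot s k) (U : Set c.Q), FinSupp A U ∧ W = ProWords.val c ⁻¹' U},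
    ⟨?_, ?_, fun U hU => hU, ?_⟩, ?_⟩
  · rintro _ ⟨c, U, hU, rfl⟩
    exact proWordsTop_isOpen_preimage c hU
  · rintro π _ ⟨c, U, hU, rfl⟩
    exact ⟨c, π • U, hU.smul π, smul_preimage (ProWords.val_equivariant c) π U⟩
  · rintro W ⟨F, hF, hFB, rfl⟩
    suffices ∃ (c : SQuot s k) (U : Set c.Q), FinSupp A U ∧ ⋂₀ F = ProWords.val c ⁻¹' U by
      obtain ⟨c, U, hU, heq⟩ := this
      exact ⟨{⋂₀ F}, finSupp_singleton (heq ▸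
        (smul_preimage_set (ProWords.val_equivariant c)).finSupp hU),
        by rintro _ rfl; exact ⟨c, U, hU, heq⟩, by simp⟩
    induction F, hF using Set.Finite.induction_on with
    | empty =>
      exact ⟨(SQuot.nonempty hs).some, Set.univ, ⟨∅, fun _ _ => Set.smul_set_univ⟩, by simp⟩
    | @insert V F _ _ ih =>
      obtain ⟨c, U, hU, heq⟩ := ih ((Set.subset_insert _ _).trans hFB)
      obtain ⟨d, P, hP, rfl⟩ := hFB (Set.mem_insert _ _)
      obtain ⟨e, hec, hed⟩ := SQuot.exists_le_le hs c d
      refine ⟨e, e.conn d.toEqCon hed ⁻¹' P ∩ e.conn c.toEqCon hec ⁻¹' U,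
        ((smul_preimage_set (e.conn_smul d.toEqCon hed)).finSupp hP).map₂
          ((smul_preimage_set (e.conn_smul c.toEqCon hec)).finSupp hU) (· ∩ ·)
          (fun _ => Set.smul_set_inter.symm), ?_⟩
      rw [Set.sInter_insert, heq]
      ext x
      simp only [Set.mem_inter_iff, Set.mem_preimage, ProWords.conn_val]
  · rintro _ ⟨c, U, hU, rfl⟩
    exact ⟨c.Q, _, ProWords.val c, U, c.nominal, c.orbitFinite, ProWords.val_equivariant c,
      fun V hV => proWordsTop_isOpen_preimage c hV, hU, rfl⟩

theorem proWordsTop_isKBoundedStone (hs : ∀ w, (s w).card ≤ k) :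
    (proWordsTop s k).IsKBoundedStone k :=
  ⟨ProWords.isNominal hs, ProWords.isKBounded hs, proWordsTop_isCompact hs,
    proWordsTop_isHausdorff hs, proWordsTop_exists_basis hs⟩

/-- The clopen sets are the finitely supported sets that are saturated for some projection. -/
theorem isSaturationAlgebra_cloAlg (hs : ∀ w, (s w).card ≤ k) :
    IsSaturationAlgebra (cloAlg (proWordsTop s k)) (fun c : SQuot s k => ProWords.val c) k where
  equivariant c := ProWords.val_equivariant c
  nominal c := c.nominal
  orbitFinite c := c.orbitFinite
  kBounded c := c.kBounded
  nonempty := SQuot.nonempty hs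
  directed c d := by
    obtain ⟨e, hec, hed⟩ := SQuot.exists_le_le hs c d
    exact ⟨e, fun x y h => ⟨ProWords.val_eq_of_le hec h, ProWords.val_eq_of_le hed h⟩⟩
  mem_iff C := by
    constructor
    · rintro ⟨hC, hC'⟩
      have hfs := (proWordsTop s k).finSupp C hC
      refine ⟨hfs, ?_⟩
      -- Each fibre of a suitable projection lies inside `C` or inside its complement, which is
      -- saturation.
      obtain ⟨c, hc⟩ := proWordsTop_exists_fibre_subset hs (𝒞 := {C, Cᶜ})
        (hfs.map (fun C => ({C, Cᶜ} : Set (Set (ProWords s k)))) fun π => by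
          rw [← Set.smul_set_compl]
          exact (Set.image_pair _ _ _).symm)
        (by rintro U (rfl | rfl); exacts [hC, hC']) (by rw [Set.sUnion_pair, Set.union_compl_self])
      refine ⟨c, fun x y hxy hx => ?_⟩
      obtain ⟨U, rfl | rfl, hU⟩ := hc (x.val c)
      · exact hU hxy.symm
      · exact absurd hx (hU rfl)
    · rintro ⟨hfs, c, hc⟩
      obtain ⟨P, hP, rfl⟩ := (saturated_iff (ProWords.val_equivariant c)).1 ⟨hfs, hc⟩
      exact ⟨proWordsTop_isOpen_preimage c hP, proWordsTop_isOpen_preimage c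
        (hP.map (fun P => Pᶜ) fun _ => Set.smul_set_compl.symm)⟩

/-- The right-hand side is closed because `P` has a finitely supported complement. Conversely, a
neighbourhood of `x` contains a fibre, and a word agreeing with `x` on a common refinement lies both
in that neighbourhood and in the language. -/
theorem closure_eta_image (hs : ∀ w, (s w).card ≤ k) (c : SQuot s k) {P : Set c.Q}
    (hP : FinSupp A P) :
    (proWordsTop s k).closure (eta s k '' (c.proj ⁻¹' P)) = ProWords.val c ⁻¹' P := by
  apply Set.Subset.antisymm
  · refine Set.sInter_subset_of_mem ⟨proWordsTop_isOpen_preimage c (U := Pᶜ)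
      (hP.map (fun P => Pᶜ) fun _ => Set.smul_set_compl.symm), ?_⟩
    rintro _ ⟨w, hw, rfl⟩
    exact hw
  · rintro x hx C ⟨hC, hsub⟩
    by_contra hxC
    obtain ⟨d, hd⟩ := ((proWordsTop_isOpen_iff hs _).1 hC).2 x hxC
    obtain ⟨e, hec, hed⟩ := SQuot.exists_le_le hs c d
    obtain ⟨w, hw⟩ := x.exists_eta_val_eq e
    refine hd _ (ProWords.val_eq_of_le hed hw) (hsub ⟨w, ?_, rfl⟩)
    have h : (eta s k w).val c ∈ P := by rwa [ProWords.val_eq_of_le hec hw]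
    exact h

end ProWords

/-! ### Languages as clopen sets, points as prime filters -/

section Duality

variable {A : Type v} [Infinite A] {Al : Type u} [MulAction (FinPerm A) Al]
  {s : FreeMonoid Al → Finset A} {k : ℕ}

theorem mem_recAlg_iff (hs : ∀ w, (s w).card ≤ k) {L : Set (FreeMonoid Al)} :
    L ∈ (recAlg s).toSub ↔ ∃ (c : SQuot s k) (P : Set c.Q), FinSupp A P ∧ L = c.proj ⁻¹' P :=
  sRecognizable_iff hs L

theorem mem_cloAlg_iff (hs : ∀ w, (s w).card ≤ k) {C : Set (ProWords s k)} :
    C ∈ (cloAlg (proWordsTop s k)).toSub ↔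
      ∃ (c : SQuot s k) (P : Set c.Q), FinSupp A P ∧ C = ProWords.val c ⁻¹' P := by
  rw [(isSaturationAlgebra_cloAlg hs).mem_iff, ← exists_and_left]
  exact exists_congr fun c => saturated_iff (ProWords.val_equivariant c)

/-- The isomorphism between recognizable languages and clopen sets. -/
def recCloIso (hs : ∀ w, (s w).card ≤ k) :
    (recAlg s).El ≃o (cloAlg (proWordsTop s k)).El where
  toFun L := ⟨(proWordsTop s k).closure (eta s k '' L.1), by
    obtain ⟨c, P, hP, hL⟩ := (mem_recAlg_iff hs).1 L.2
    rw [hL, closure_eta_image hs c hP]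
    exact (mem_cloAlg_iff hs).2 ⟨c, P, hP, rfl⟩⟩
  invFun C := ⟨eta s k ⁻¹' C.1, by
    obtain ⟨c, P, hP, hC⟩ := (mem_cloAlg_iff hs).1 C.2
    rw [hC]
    exact (mem_recAlg_iff hs).2 ⟨c, P, hP, rfl⟩⟩
  left_inv L := by
    refine Subtype.ext ?_
    obtain ⟨c, P, hP, hL⟩ := (mem_recAlg_iff hs).1 L.2
    change eta s k ⁻¹' ((proWordsTop s k).closure (eta s k '' L.1)) = L.1
    rw [hL, closure_eta_image hs c hP]
    rfl
  right_inv C := by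
    refine Subtype.ext ?_
    obtain ⟨c, P, hP, hC⟩ := (mem_cloAlg_iff hs).1 C.2
    change (proWordsTop s k).closure (eta s k '' (eta s k ⁻¹' C.1)) = C.1
    rw [hC]
    exact closure_eta_image hs c hP
  map_rel_iff' := by
    intro L M
    constructor
    · intro h
      have hmem : ∀ N : (recAlg s).El, ∀ w : FreeMonoid Al,
          eta s k w ∈ (proWordsTop s k).closure (eta s k '' N.1) ↔ w ∈ N.1 := by
        intro N w
        obtain ⟨c, P, hP, hN⟩ := (mem_recAlg_iff hs).1 N.2
        rw [hN, closure_eta_image hs c hP]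
        rfl
      intro w hw
      exact (hmem M w).1 (h ((hmem L w).2 hw))
    · intro h x hx C hC
      exact hx C ⟨hC.1, (Set.image_mono (f := eta s k) (s := L.1) (t := M.1) h).trans hC.2⟩

/-- Checked on the inverse, which is a preimage under the equivariant map `eta`. -/
theorem recCloIso_equivariant (hs : ∀ w, (s w).card ≤ k) :
    Equivariant A (recCloIso hs : (recAlg s).El ≃o (cloAlg (proWordsTop s k)).El) := by
  refine Equivariant.symm (f := (recCloIso hs).toEquiv.symm) fun π C => Subtype.ext ?_
  exact smul_preimage_set eta_equivariant π C.1

theorem mem_recCloIso_iff (hs : ∀ w, (s w).card ≤ k) (c : SQuot s k) {P : Set c.Q}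
    (hP : FinSupp A P) (L : (recAlg s).El) (hL : L.1 = c.proj ⁻¹' P) (x : ProWords s k) :
    x ∈ (recCloIso hs L).1 ↔ x.val c ∈ P := by
  change x ∈ (proWordsTop s k).closure (eta s k '' L.1) ↔ _
  rw [hL, closure_eta_image hs c hP]
  rfl

/-- Orbit-finite joins of clopen sets are unions, so a point of the join lies in one of the members.
-/
theorem isPrimeFilter_point (hs : ∀ w, (s w).card ≤ k) (x : ProWords s k) :
    IsPrimeFilter A k {L : (recAlg s).El | x ∈ (recCloIso hs L).1} where
  finSupp := (ProWords.isNominal hs x).map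
    (fun x => {L : (recAlg s).El | x ∈ (recCloIso hs L).1}) fun π => by
      ext L
      rw [Set.mem_smul_set_iff_inv_smul_mem]
      change π • x ∈ (recCloIso hs L).1 ↔ x ∈ (recCloIso hs (π⁻¹ • L)).1
      rw [recCloIso_equivariant]
      exact (Set.mem_inv_smul_set_iff (A := (recCloIso hs L).1)).symm
  nonempty := ⟨⊤, by
    rw [Set.mem_ofPred_eq, map_top]
    trivial⟩
  upward L M hL hLM := (recCloIso hs).monotone hLM hL
  inf_mem L M hL hM := by
    rw [Set.mem_ofPred_eq, map_inf]
    exact ⟨hL, hM⟩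
  prime Y b hY _ hb hxb := by
    have hY' : OrbitFiniteSet A (recCloIso hs '' Y) := by
      obtain ⟨R, -, hR, hrep⟩ := hY.exists_reps
      refine OrbitFiniteSet.of_reps ((smul_image_set (recCloIso_equivariant hs)).finSupp hY.1)
        (hR.image (recCloIso hs)) ?_
      rintro _ ⟨y, hy, rfl⟩
      obtain ⟨r, hr, π, rfl⟩ := hrep y hy
      exact ⟨π⁻¹, r, hr, by rw [← recCloIso_equivariant, inv_smul_smul]⟩
    have h := ((isSaturationAlgebra_cloAlg hs).isLUB_iff hY' _).1
      ((recCloIso hs).isLUB_image'.2 hb)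
    rw [Set.mem_ofPred_eq, h] at hxb
    obtain ⟨_, ⟨_, ⟨L, hL, rfl⟩, rfl⟩, hx⟩ := hxb
    exact ⟨L, hL, hx⟩

/-- Every prime filter of recognizable languages is the filter of a point. -/
theorem exists_point (hs : ∀ w, (s w).card ≤ k) {F : Set (recAlg s).El}
    (hF : IsPrimeFilter A k F) :
    ∃ x : ProWords s k, {L : (recAlg s).El | x ∈ (recCloIso hs L).1} = F := by
  have hR := isSaturationAlgebra_recAlg (A := A) (s := s) hs
  -- The fibres over `c.Q` cover all words, so their join is `⊤`, which lies in `F`. They are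
  -- orbit-finite and `k`-bounded, exactly as primeness demands.
  have hex : ∀ c, ∃ q : c.Q, hR.fibre c q ∈ F := by
    intro c
    obtain ⟨L, hL⟩ := hF.nonempty
    have hlub : IsLUB (Set.range (hR.fibre c)) (⊤ : (recAlg s).El) := by
      refine (hR.isLUB_iff (hR.orbitFiniteSet_range_fibre c) _).2 ?_
      refine (Set.eq_univ_of_forall fun w => ?_).symm
      exact ⟨_, ⟨_, ⟨c.proj w, rfl⟩, rfl⟩, rfl⟩
    obtain ⟨_, ⟨q, rfl⟩, hq⟩ := hF.prime _ _ (hR.orbitFiniteSet_range_fibre c)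
      (hR.kBoundedSet_range_fibre c) hlub (hF.upward _ _ hL le_top)
    exact ⟨q, hq⟩
  choose x hx using hex
  have hmeet : ∀ L M : (recAlg s).El, L ∈ F → M ∈ F → ∃ w, w ∈ L.1 ∧ w ∈ M.1 := by
    intro L M hL hM
    by_contra h
    refine hF.bot_notMem ?_
    have h0 : L ⊓ M = ⊥ := Subtype.ext (Set.eq_empty_of_forall_notMem
      (s := L.1 ∩ M.1) fun w hw => h ⟨w, hw⟩)
    rw [← h0]
    exact hF.inf_mem _ _ hL hM
  -- Compatibility: the fibres chosen at `c` and `d` share a word, whose projections are `x c` and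
  -- `x d`.
  let p : ProWords s k := ⟨x, fun c d h => by
    obtain ⟨w, hwc, hwd⟩ := hmeet _ _ (hx c) (hx d)
    have hwc' : c.proj w = x c := hwc
    have hwd' : d.proj w = x d := hwd
    rw [← hwc', ← hwd', EqCon.conn_proj]⟩
  refine ⟨p, ?_⟩
  ext L
  obtain ⟨c, P, hP, hL⟩ := (mem_recAlg_iff hs).1 L.2
  rw [Set.mem_ofPred_eq, mem_recCloIso_iff hs c hP L hL]
  constructor
  · intro h
    refine hF.upward _ _ (hx c) fun w hw => ?_
    have hw' : c.proj w = x c := hw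
    rw [hL, Set.mem_preimage, hw']
    exact h
  · intro h
    obtain ⟨w, hw, hwL⟩ := hmeet _ _ (hx c) h
    have hw' : c.proj w = x c := hw
    rw [hL, Set.mem_preimage, hw'] at hwL
    exact hwL

/-- The prime filter of a point. -/
def pointFilter (hs : ∀ w, (s w).card ≤ k) (x : ProWords s k) : PrimeFilters A (recAlg s).El k :=
  ⟨_, isPrimeFilter_point hs x⟩

theorem mem_pointFilter (hs : ∀ w, (s w).card ≤ k) (x : ProWords s k) (L : (recAlg s).El) :
    L ∈ (pointFilter hs x).1 ↔ x ∈ (recCloIso hs L).1 := Iff.rfl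

/-- For injectivity, the fibre over `x.val c`, as a language, belongs to the filter of exactly those
points that agree with `x` at `c`. -/
theorem pointFilter_bijective (hs : ∀ w, (s w).card ≤ k) :
    Function.Bijective (pointFilter (A := A) (s := s) hs) := by
  constructor
  · intro x y hxy
    refine ProWords.ext fun c => ?_
    have hR := isSaturationAlgebra_recAlg (A := A) (s := s) hs
    have hiff : ∀ z : ProWords s k,
        hR.fibre c (x.val c) ∈ (pointFilter hs z).1 ↔ z.val c = x.val c := fun z =>
      mem_recCloIso_iff hs c (finSupp_singleton (c.nominal (x.val c))) _ rfl z
    exact ((hiff y).1 (hxy ▸ (hiff x).2 rfl)).symm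
  · intro F
    obtain ⟨x, hx⟩ := exists_point hs F.2
    exact ⟨x, Subtype.ext hx⟩

theorem pointFilter_equivariant (hs : ∀ w, (s w).card ≤ k) :
    Equivariant A (pointFilter (A := A) (s := s) hs) := by
  intro π x
  refine Subtype.ext (Set.ext fun L => ?_)
  change π • x ∈ (recCloIso hs L).1 ↔ L ∈ π • (pointFilter hs x).1
  rw [Set.mem_smul_set_iff_inv_smul_mem, mem_pointFilter, recCloIso_equivariant]
  exact (Set.mem_inv_smul_set_iff (A := (recCloIso hs L).1)).symm

/-- The homeomorphism between pro-orbit-finite words and prime filters. -/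
noncomputable def pointFilterEquiv (hs : ∀ w, (s w).card ≤ k) :
    ProWords s k ≃ PrimeFilters A (recAlg s).El k :=
  Equiv.ofBijective _ (pointFilter_bijective hs)

/-- The subbases match: the basic set of a language pulls back to the corresponding clopen set, and
a subbasic set at coordinate `c` is the basic set of a language recognized by `c`. -/
theorem pointFilterEquiv_isIso (hs : ∀ w, (s w).card ≤ k) :
    (proWordsTop s k).IsIso (primeFilterTop A (recAlg s).El k) (pointFilterEquiv hs) := by
  have heq : Equivariant A (pointFilterEquiv (A := A) (s := s) hs) := pointFilter_equivariant hs
  refine ⟨heq, NomTop.continuous_generate _ _ heq ?_, NomTop.continuous_generate _ _ heq.symm ?_⟩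
  · rintro _ ⟨b, rfl⟩
    exact (recCloIso hs b).2.1
  · rintro _ ⟨c, U, hU, rfl⟩
    have hmem : c.proj ⁻¹' U ∈ (recAlg s).toSub := (mem_recAlg_iff hs).2 ⟨c, U, hU, rfl⟩
    have hset : (pointFilterEquiv hs).symm ⁻¹' {x : ProWords s k | x.1 c ∈ U} =
        {F | (⟨_, hmem⟩ : (recAlg s).El) ∈ F.1} := by
      ext F
      obtain ⟨x, rfl⟩ := (pointFilterEquiv hs).surjective F
      rw [Set.mem_preimage, Equiv.symm_apply_apply]
      exact (mem_recCloIso_iff hs c hU ⟨_, hmem⟩ rfl x).symm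
    refine NomTop.generate_isOpen_of_mem _ ⟨_, hset⟩ ?_
    exact (smul_preimage_set heq.symm).finSupp
      ((smul_preimage_set (ProWords.val_equivariant c)).finSupp hU)

end Duality

end NominalStone

/-! ### The duality theorem -/

theorem mainTheorem4 {A : Type v} [Countable A] [Infinite A] {Al : Type u}
    [MulAction (FinPerm A) Al] (hAl : IsNominal A Al) (hof : OrbitFinite A Al) (k : ℕ)
    (s : FreeMonoid Al → Finset A) (hs : ∀ w, (s w).card ≤ k) :
    (proWordsTop s k).IsKBoundedStone k ∧
    IsLocallyKAtomicOFCBA A (recAlg s).El k ∧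
    IsLocallyKAtomicOFCBA A (cloAlg (proWordsTop s k)).El k ∧
    (primeFilterTop A (recAlg s).El k).IsKBoundedStone k ∧
    ∃ φ : (recAlg s).El ≃ (cloAlg (proWordsTop s k)).El,
      IsOFCIso A φ ∧
      (∀ L : (recAlg s).El,
        (φ L : Set (ProWords s k)) = (proWordsTop s k).closure (eta s k '' (L : Set _))) ∧
      (∀ C : (cloAlg (proWordsTop s k)).El,
        (φ.symm C : Set (FreeMonoid Al)) = eta s k ⁻¹' (C : Set _)) ∧
      ∃ ψ : ProWords s k ≃ PrimeFilters A (recAlg s).El k,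
        (proWordsTop s k).IsIso (primeFilterTop A (recAlg s).El k) ψ ∧
        ∀ (x : ProWords s k) (L : (recAlg s).El),
          L ∈ (ψ x).1 ↔ x ∈ (φ L : Set (ProWords s k)) :=
  ⟨proWordsTop_isKBoundedStone hs,
    (isSaturationAlgebra_recAlg hs).isLocallyKAtomicOFCBA,
    (isSaturationAlgebra_cloAlg hs).isLocallyKAtomicOFCBA,
    isKBoundedStone_of_isIso (pointFilterEquiv_isIso hs) (proWordsTop_isKBoundedStone hs),
    (recCloIso hs).toEquiv, isOFCIso_of_orderIso _ (recCloIso_equivariant hs), fun _ => rfl,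
    fun _ => rfl, pointFilterEquiv hs, pointFilterEquiv_isIso hs, fun _ _ => Iff.rfl⟩
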